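/- **Theorem 4.8.** Let $\mathsf B$ be a category with (chosen) finite products, with terminal object $I_{\mathsf B}$, and let $P\colon\mathsf X\to\mathsf B$ be an opfibration: every $f\colon A\to A'$ in $\mathsf B$ has, at every $X$ over $A$, a cocartesian lifting. Choose such liftings $\hat f\colon X\to f_*X$, and let $F\colon\mathsf B\to\mathbf{CAT}$ be the associated pseudofunctor: $F(A)$ is the fibre of $P$ over $A$, $F(f)=f_*$, and the coherence isomorphisms are those given by the universal property of the liftings. Let $\mathsf I$ be the terminal category, with object $\star$, and $\mathbb I$ the terminal $2$-category. Let $L^1\colon F(I_{\mathsf B})\to\mathsf I$ be the unique functor, regarded as a pseudonatural transformation of pseudofunctors $\mathbb I\to\mathbf{CAT}$, and let $L$ be the pseudonatural transformation, of pseudofunctors $\mathsf B\times\mathsf B\to\mathbf{CAT}$, with components $$L^{A,B}=\langle F(\pi_1),F(\pi_2)\rangle\colon F(A\times B)\to F(A)\times F(B),$$ whose invertible $2$-cell at a pair of arrows $(a,b)$ is given by the coherence isomorphisms of $F$ at $\pi_1\circ(a\times b)=a\circ\pi_1$ and $\pi_2\circ(a\times b)=b\circ\pi_2$. Then the following are equivalent.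 (i) $\mathsf X$ has finite products and, for a suitable choice of them, $P\colon(\mathsf X,\times,I_{\mathsf X})\to(\mathsf B,\times,I_{\mathsf B})$ is a monoidal opfibration, i.e. $P$ is a strict monoidal functor and the product of two cocartesian arrows is cocartesian. (ii) $L^1$ has a right adjoint $R^1$ in the $2$-category of pseudofunctors $\mathbb I\to\mathbf{CAT}$, pseudonatural transformations and modifications, and $L$ has a right adjoint $R$ in the $2$-category of pseudofunctors $\mathsf B\times\mathsf B\to\mathbf{CAT}$, pseudonatural transformations and modifications. (iii) $F$ admits a lax symmetric monoidal structure $$(F,R,R^1,\omega',\zeta',\xi',\theta')\colon(\mathsf B,\times,I_{\mathsf B})\to(\mathbf{CAT},\times,\mathsf I),$$ that is, pseudonatural transformations with components $R^{A,B}\colon F(A)\times F(B)\to F(A\times B)$ and $R^1\colon\mathsf I\to F(I_{\mathsf B})$, with invertible modifications $\omega'$ (associativity), $\zeta',\xi'$ (right and left unit) and $\theta'$ (symmetry) satisfying the pentagon, triangle, hexagon and symmetry coherence conditions, such that $R$ is the product of $\mathsf X$ and $R^1(\star)=I_{\mathsf X}$. Explicitly: $R^1(\star)$ is terminal in $\mathsf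 X$; for $X$ over $A$ and $Y$ over $B$, $R^{A,B}(X,Y)=X\times Y$ is a product of $X$ and $Y$ in $\mathsf X$ with projections lying over those of $A\times B$; for vertical arrows $u,v$ one has $R(u,v)=u\times v$; and for $a\colon A\to A'$ and $b\colon B\to B'$ the component $R^{(a,b)}_{X,Y}\colon(a\times b)_*(X\times Y)\to a_*X\times b_*Y$ of the pseudonatural transformation $R$ is the comparison with $R^{(a,b)}_{X,Y}\circ\widehat{a\times b}=\hat a\times\hat b$. -/

import Mathlib

open CategoryTheory

universe v₁ v₂ u₁ u₂

namespace CartOpfib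


section Opfibration
open Functor

variable {𝒮 : Type u₁} [Category.{v₁} 𝒮] {𝒳 : Type u₂} [Category.{v₂} 𝒳]

/-- The inclusion in `𝒳` of the fibre of `P` over `A`, the category of the objects of `𝒳` over `A`
and of the arrows over `𝟙 A` (the vertical arrows). -/
abbrev incl {P : 𝒳 ⥤ 𝒮} {A : 𝒮} : P.Fiber A ⥤ 𝒳 := Fiber.fiberInclusion

/-- A functor `P` is an opfibration if every arrow `f : A ⟶ A'` has a cocartesian lifting at every
object `X` over `A`. A cleavage is a choice of such liftings `X ⟶ f_* X`. It is not assumed to be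
normalized or split. -/
structure Cleavage (P : 𝒳 ⥤ 𝒮) where
  /-- The object `f_* X`. -/
  obj {A A' : 𝒮} (f : A ⟶ A') (X : P.Fiber A) : P.Fiber A'
  /-- The lifting `X ⟶ f_* X` of `f`. -/
  lift {A A' : 𝒮} (f : A ⟶ A') (X : P.Fiber A) : incl.obj X ⟶ incl.obj (obj f X)
  cocartesian {A A' : 𝒮} (f : A ⟶ A') (X : P.Fiber A) : P.IsStronglyCocartesian f (lift f X)

namespace Cleavage

variable {P : 𝒳 ⥤ 𝒮} (c : Cleavage P)

attribute [instance] Cleavage.cocartesian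

instance isHomLift_id {A : 𝒮} (X : P.Fiber A) : P.IsHomLift (𝟙 A) (𝟙 (incl.obj X)) :=
  IsHomLift.id X.2

/-- A vertical arrow of `𝒳` as an arrow of the fibre. -/
def vert {A : 𝒮} {X Y : P.Fiber A} (φ : incl.obj X ⟶ incl.obj Y) (h : P.IsHomLift (𝟙 A) φ) :
    X ⟶ Y := ⟨φ, h⟩

@[simp]
theorem incl_vert {A : 𝒮} {X Y : P.Fiber A} (φ : incl.obj X ⟶ incl.obj Y)
    (h : P.IsHomLift (𝟙 A) φ) : incl.map (vert φ h) = φ := rfl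

theorem vert_ext {A A' : 𝒮} (f : A ⟶ A') {X : P.Fiber A} {Y Z : P.Fiber A'}
    (φ : incl.obj X ⟶ incl.obj Y) [P.IsStronglyCocartesian f φ] {u v : Y ⟶ Z}
    (h : φ ≫ incl.map u = φ ≫ incl.map v) : u = v :=
  incl.map_injective (IsStronglyCocartesian.ext P f φ (𝟙 A') h)

/-- The vertical arrow `u : Y ⟶ Z` with `φ ≫ u = ψ`, where `φ` and `ψ` are arrows over `f` and
`φ` is cocartesian. -/
noncomputable def desc {A A' : 𝒮} (f : A ⟶ A') {X : P.Fiber A} {Y Z : P.Fiber A'}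
    (φ : incl.obj X ⟶ incl.obj Y) (ψ : incl.obj X ⟶ incl.obj Z)
    [P.IsStronglyCocartesian f φ] [P.IsHomLift f ψ] : Y ⟶ Z :=
  vert (IsCocartesian.map P f φ ψ) inferInstance

@[simp]
theorem fac {A A' : 𝒮} (f : A ⟶ A') {X : P.Fiber A} {Y Z : P.Fiber A'}
    (φ : incl.obj X ⟶ incl.obj Y) (ψ : incl.obj X ⟶ incl.obj Z)
    [P.IsStronglyCocartesian f φ] [P.IsHomLift f ψ] : φ ≫ incl.map (desc f φ ψ) = ψ :=
  IsCocartesian.fac P f φ ψ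

@[simp]
theorem fac_assoc {A A' : 𝒮} (f : A ⟶ A') {X : P.Fiber A} {Y Z : P.Fiber A'}
    (φ : incl.obj X ⟶ incl.obj Y) (ψ : incl.obj X ⟶ incl.obj Z)
    [P.IsStronglyCocartesian f φ] [P.IsHomLift f ψ] {W : 𝒳} (h : incl.obj Z ⟶ W) :
    φ ≫ incl.map (desc f φ ψ) ≫ h = ψ ≫ h := by
  rw [← Category.assoc, fac]

/-- Two cocartesian arrows over `f` with the same domain have isomorphic codomains. -/
noncomputable def compare {A A' : 𝒮} (f : A ⟶ A') {X : P.Fiber A} {Y Z : P.Fiber A'}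
    (φ : incl.obj X ⟶ incl.obj Y) (ψ : incl.obj X ⟶ incl.obj Z)
    [P.IsStronglyCocartesian f φ] [P.IsStronglyCocartesian f ψ] : Y ≅ Z where
  hom := desc f φ ψ
  inv := desc f ψ φ
  hom_inv_id := vert_ext f φ (by simp)
  inv_hom_id := vert_ext f ψ (by simp)

@[simp]
theorem compare_hom_fac {A A' : 𝒮} (f : A ⟶ A') {X : P.Fiber A} {Y Z : P.Fiber A'}
    (φ : incl.obj X ⟶ incl.obj Y) (ψ : incl.obj X ⟶ incl.obj Z)
    [P.IsStronglyCocartesian f φ] [P.IsStronglyCocartesian f ψ] :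
    φ ≫ incl.map (compare f φ ψ).hom = ψ := fac f φ ψ

@[simp]
theorem compare_hom_fac_assoc {A A' : 𝒮} (f : A ⟶ A') {X : P.Fiber A} {Y Z : P.Fiber A'}
    (φ : incl.obj X ⟶ incl.obj Y) (ψ : incl.obj X ⟶ incl.obj Z)
    [P.IsStronglyCocartesian f φ] [P.IsStronglyCocartesian f ψ] {W : 𝒳} (h : incl.obj Z ⟶ W) :
    φ ≫ incl.map (compare f φ ψ).hom ≫ h = ψ ≫ h := fac_assoc f φ ψ h

@[simp]
theorem compare_inv_fac {A A' : 𝒮} (f : A ⟶ A') {X : P.Fiber A} {Y Z : P.Fiber A'}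
    (φ : incl.obj X ⟶ incl.obj Y) (ψ : incl.obj X ⟶ incl.obj Z)
    [P.IsStronglyCocartesian f φ] [P.IsStronglyCocartesian f ψ] :
    ψ ≫ incl.map (compare f φ ψ).inv = φ := fac f ψ φ

/-- The change of base functor `f_*` between the fibres. -/
noncomputable def push {A A' : 𝒮} (f : A ⟶ A') : P.Fiber A ⥤ P.Fiber A' where
  obj X := c.obj f X
  map {X Y} u := desc f (c.lift f X) (incl.map u ≫ c.lift f Y)
  map_id X := vert_ext f (c.lift f X) (by simp)
  map_comp {X Y Z} u v := vert_ext f (c.lift f X) (by simp)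

/-- The cocartesian lifting of `f` at `X`, as an arrow into the value of the functor `f_*`. -/
def hat {A A' : 𝒮} (f : A ⟶ A') (X : P.Fiber A) : incl.obj X ⟶ incl.obj ((c.push f).obj X) :=
  c.lift f X

instance {A A' : 𝒮} (f : A ⟶ A') (X : P.Fiber A) : P.IsStronglyCocartesian f (c.hat f X) :=
  c.cocartesian f X

@[simp]
theorem hat_push_map {A A' : 𝒮} (f : A ⟶ A') {X Y : P.Fiber A} (u : X ⟶ Y) :
    c.hat f X ≫ incl.map ((c.push f).map u) = incl.map u ≫ c.hat f Y :=
  fac f (c.lift f X) (incl.map u ≫ c.lift f Y)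

@[simp]
theorem hat_push_map_assoc {A A' : 𝒮} (f : A ⟶ A') {X Y : P.Fiber A} (u : X ⟶ Y) {W : 𝒳}
    (h : incl.obj ((c.push f).obj Y) ⟶ W) :
    c.hat f X ≫ incl.map ((c.push f).map u) ≫ h = incl.map u ≫ c.hat f Y ≫ h :=
  (fac_assoc f (c.lift f X) (incl.map u ≫ c.lift f Y) h).trans (Category.assoc _ _ _)

/-- The isomorphism `φ¹ : (𝟙 A)_* ≅ 1`, given by the universal property of the liftings. -/
noncomputable def pushId (A : 𝒮) : c.push (𝟙 A) ≅ 𝟭 (P.Fiber A) :=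
  NatIso.ofComponents
    (fun X => compare (𝟙 A) (Z := X) (c.hat (𝟙 A) X) (𝟙 (incl.obj X)))
    (fun {X Y} u => vert_ext (𝟙 A) (c.hat (𝟙 A) X) (by simp))

/-- The isomorphism `φ : (f ≫ g)_* ≅ g_* f_*`, given by the universal property of the liftings. -/
noncomputable def pushComp {A A' A'' : 𝒮} (f : A ⟶ A') (g : A' ⟶ A'') :
    c.push (f ≫ g) ≅ c.push f ⋙ c.push g :=
  NatIso.ofComponents
    (fun X => compare (f ≫ g) (Z := (c.push g).obj ((c.push f).obj X)) (c.hat (f ≫ g) X)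
      (c.hat f X ≫ c.hat g ((c.push f).obj X)))
    (fun {X Y} u => vert_ext (f ≫ g) (c.hat (f ≫ g) X) (by simp))

@[simp]
theorem hat_pushId (A : 𝒮) (X : P.Fiber A) :
    c.hat (𝟙 A) X ≫ incl.map ((c.pushId A).hom.app X) = 𝟙 _ :=
  compare_hom_fac (𝟙 A) (Z := X) (c.hat (𝟙 A) X) (𝟙 (incl.obj X))

@[simp]
theorem hat_pushId_assoc (A : 𝒮) (X : P.Fiber A) {W : 𝒳} (h : incl.obj X ⟶ W) :
    c.hat (𝟙 A) X ≫ incl.map ((c.pushId A).hom.app X) ≫ h = h :=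
  (compare_hom_fac_assoc (𝟙 A) (Z := X) (c.hat (𝟙 A) X) (𝟙 (incl.obj X)) h).trans
    (Category.id_comp h)

@[simp]
theorem hat_pushComp {A A' A'' : 𝒮} (f : A ⟶ A') (g : A' ⟶ A'') (X : P.Fiber A) :
    c.hat (f ≫ g) X ≫ incl.map ((c.pushComp f g).hom.app X) =
      c.hat f X ≫ c.hat g ((c.push f).obj X) :=
  compare_hom_fac (f ≫ g) (Z := (c.push g).obj ((c.push f).obj X)) (c.hat (f ≫ g) X)
      (c.hat f X ≫ c.hat g ((c.push f).obj X))

@[simp]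
theorem hat_pushComp_assoc {A A' A'' : 𝒮} (f : A ⟶ A') (g : A' ⟶ A'') (X : P.Fiber A) {W : 𝒳}
    (h : incl.obj ((c.push g).obj ((c.push f).obj X)) ⟶ W) :
    c.hat (f ≫ g) X ≫ incl.map ((c.pushComp f g).hom.app X) ≫ h =
      c.hat f X ≫ c.hat g ((c.push f).obj X) ≫ h :=
  (compare_hom_fac_assoc (f ≫ g) (Z := (c.push g).obj ((c.push f).obj X)) (c.hat (f ≫ g) X)
    (c.hat f X ≫ c.hat g ((c.push f).obj X)) h).trans (Category.assoc _ _ _)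

@[simp]
theorem hat_pushComp_inv {A A' A'' : 𝒮} (f : A ⟶ A') (g : A' ⟶ A'') (X : P.Fiber A) :
    c.hat f X ≫ c.hat g ((c.push f).obj X) ≫ incl.map ((c.pushComp f g).inv.app X) =
      c.hat (f ≫ g) X := by
  rw [← Category.assoc]
  exact compare_inv_fac (f ≫ g) (Z := (c.push g).obj ((c.push f).obj X)) (c.hat (f ≫ g) X)
      (c.hat f X ≫ c.hat g ((c.push f).obj X))

@[simp]
theorem hat_pushComp_inv_assoc {A A' A'' : 𝒮} (f : A ⟶ A') (g : A' ⟶ A'') (X : P.Fiber A) {W : 𝒳}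
    (h : incl.obj ((c.push (f ≫ g)).obj X) ⟶ W) :
    c.hat f X ≫ c.hat g ((c.push f).obj X) ≫ incl.map ((c.pushComp f g).inv.app X) ≫ h =
      c.hat (f ≫ g) X ≫ h := by
  rw [← c.hat_pushComp_inv f g X]
  simp only [Category.assoc]

theorem hat_eqToHom {A A' : 𝒮} {f g : A ⟶ A'} (h : f = g) (X : P.Fiber A) :
    c.hat f X ≫ incl.map (eqToHom (by rw [h]) : (c.push f).obj X ⟶ (c.push g).obj X) =
      c.hat g X := by
  subst h; simp

theorem pushComp_assoc {A₀ A₁ A₂ A₃ : 𝒮} (f : A₀ ⟶ A₁) (g : A₁ ⟶ A₂) (h : A₂ ⟶ A₃)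
    (X : P.Fiber A₀) :
    (c.pushComp (f ≫ g) h).hom.app X ≫ (c.push h).map ((c.pushComp f g).hom.app X) ≫
      (c.pushComp g h).inv.app ((c.push f).obj X) ≫ (c.pushComp f (g ≫ h)).inv.app X =
      eqToHom (by rw [Category.assoc]) := by
  apply vert_ext ((f ≫ g) ≫ h) (c.hat ((f ≫ g) ≫ h) X)
  rw [c.hat_eqToHom (Category.assoc f g h)]
  simp only [Functor.map_comp]
  rw [c.hat_pushComp_assoc]
  erw [c.hat_push_map_assoc]
  rw [c.hat_pushComp_assoc]
  erw [c.hat_pushComp_inv_assoc]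
  rw [c.hat_pushComp_inv]

theorem pushComp_id_left {A A' : 𝒮} (f : A ⟶ A') (X : P.Fiber A) :
    (c.pushComp (𝟙 A) f).hom.app X ≫ (c.push f).map ((c.pushId A).hom.app X) =
      eqToHom (by simp) := by
  apply vert_ext (𝟙 A ≫ f) (c.hat (𝟙 A ≫ f) X)
  erw [c.hat_eqToHom (Category.id_comp f)]
  simp only [Functor.map_comp]
  rw [c.hat_pushComp_assoc]
  erw [c.hat_push_map]
  rw [c.hat_pushId_assoc]
  rfl

theorem pushComp_id_right {A A' : 𝒮} (f : A ⟶ A') (X : P.Fiber A) :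
    (c.pushComp f (𝟙 A')).hom.app X ≫ (c.pushId A').hom.app ((c.push f).obj X) =
      eqToHom (by simp) := by
  apply vert_ext (f ≫ 𝟙 A') (c.hat (f ≫ 𝟙 A') X)
  erw [c.hat_eqToHom (Category.comp_id f)]
  simp only [Functor.map_comp]
  rw [c.hat_pushComp_assoc]
  erw [c.hat_pushId]
  simp

/-- The pseudofunctor `𝒮 ⟶ CAT` associated with the opfibration: `A` is sent to the fibre over `A`
and `f` to `f_*`. -/
noncomputable def pseudofunctor : Pseudofunctor (LocallyDiscrete 𝒮) Cat.{v₂, u₂} :=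
  LocallyDiscrete.mkPseudofunctor
    (fun A => Cat.of (P.Fiber A))
    (fun f => (c.push f).toCatHom)
    (fun A => Cat.Hom.isoMk (c.pushId A))
    (fun f g => Cat.Hom.isoMk (c.pushComp f g))
    (fun f g h => by
      ext X
      refine Eq.trans ?_ (Cat.eqToHom_app _ _ _ _).symm
      refine Eq.trans ?_ (c.pushComp_assoc f g h X)
      exact congrArg ((c.pushComp (f ≫ g) h).hom.app X ≫ (c.push h).map _ ≫ ·)
        (Category.id_comp _))
    (fun f => by
      ext X
      refine Eq.trans ?_ (Cat.eqToHom_app _ _ _ _).symm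
      refine Eq.trans ?_ (c.pushComp_id_left f X)
      exact congrArg ((c.pushComp (𝟙 _) f).hom.app X ≫ ·) (Category.comp_id _))
    (fun f => by
      ext X
      refine Eq.trans ?_ (Cat.eqToHom_app _ _ _ _).symm
      refine Eq.trans ?_ (c.pushComp_id_right f X)
      exact congrArg ((c.pushComp f (𝟙 _)).hom.app X ≫ ·) (Category.comp_id _))

end Cleavage
end Opfibration


section General
open Bicategory

theorem isoMapOfCommSq_comp {B C : Type*} [Bicategory B] [Strict B] [Bicategory C] (F : B ⥤ᵖ C)
    {x y z x' y' z' : B} {f : x ⟶ y} {g : y ⟶ z} {fg : x ⟶ z} (h : f ≫ g = fg)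
    {f' : x' ⟶ y'} {g' : y' ⟶ z'} {fg' : x' ⟶ z'} (h' : f' ≫ g' = fg')
    {p : x ⟶ x'} {q : y ⟶ y'} {r : z ⟶ z'} (sf : CommSq f p q f') (sg : CommSq g q r g')
    (sfg : CommSq fg p r fg') :
    (F.isoMapOfCommSq sfg).hom ≫ F.map p ◁ (F.mapComp' f' g' fg' h').hom =
      (F.mapComp' f g fg h).hom ▷ F.map r ≫ (α_ _ _ _).hom ≫
        F.map f ◁ (F.isoMapOfCommSq sg).hom ≫ (α_ _ _ _).inv ≫
        (F.isoMapOfCommSq sf).hom ▷ F.map g' ≫ (α_ _ _ _).hom := by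
  have e₁ : fg ≫ r = p ≫ fg' := sfg.w
  rw [F.isoMapOfCommSq_eq sfg (fg ≫ r) rfl, F.isoMapOfCommSq_eq sg (g ≫ r) rfl,
    F.isoMapOfCommSq_eq sf (f ≫ q) rfl]
  simp only [Iso.trans_hom, Iso.symm_hom, Category.assoc, Bicategory.whiskerLeft_comp, Bicategory.comp_whiskerRight]
  rw [F.mapComp'₀₁₃_hom_comp_whiskerLeft_mapComp'_hom p f' g' (f ≫ q) fg' (fg ≫ r)
    (by rw [sf.w]) h' e₁.symm]
  rw [← F.mapComp'₀₂₃_inv_comp_mapComp'₀₁₃_hom_assoc f g r fg (g ≫ r) (fg ≫ r) h rfl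
    rfl]
  rw [← F.mapComp'₀₁₃_inv_comp_mapComp'₀₂₃_hom_assoc f q g' (f ≫ q) (g ≫ r) (fg ≫ r) rfl
    sg.w.symm (by rw [← h, Category.assoc])]
  simp

theorem isoMapOfCommSq_comp' {B C : Type*} [Bicategory B] [Strict B] [Bicategory C] (F : B ⥤ᵖ C)
    {x y z x' y' z' : B} {f : x ⟶ y} {g : y ⟶ z} {fg : x ⟶ z} (h : f ≫ g = fg)
    {f' : x' ⟶ y'} {g' : y' ⟶ z'}
    {p : x ⟶ x'} {q : y ⟶ y'} {r : z ⟶ z'} (sf : CommSq f p q f') (sg : CommSq g q r g')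
    (sfg : CommSq fg p r (f' ≫ g')) :
    (F.isoMapOfCommSq sfg).hom ≫ F.map p ◁ (F.mapComp f' g').hom =
      (F.mapComp' f g fg h).hom ▷ F.map r ≫ (α_ _ _ _).hom ≫
        F.map f ◁ (F.isoMapOfCommSq sg).hom ≫ (α_ _ _ _).inv ≫
        (F.isoMapOfCommSq sf).hom ▷ F.map g' ≫ (α_ _ _ _).hom := by
  rw [← F.mapComp'_eq_mapComp, isoMapOfCommSq_comp F h rfl sf sg sfg]

theorem isoMapOfCommSq_id {B C : Type*} [Bicategory B] [Strict B] [Bicategory C] (F : B ⥤ᵖ C)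
    {x x' : B} {t : x ⟶ x} (h : t = 𝟙 x) {p : x ⟶ x'} (s : CommSq t p p (𝟙 x')) :
    (F.isoMapOfCommSq s).hom ≫ F.map p ◁ (F.mapId x').hom =
      (F.mapId' t h).hom ▷ F.map p ≫ (λ_ _).hom ≫ (ρ_ _).inv := by
  subst h
  rw [F.isoMapOfCommSq_horiz_id, F.mapId'_eq_mapId]
  simp

variable {𝒮 : Type u₁} [Category.{v₁} 𝒮]

theorem naturality_of_locallyDiscrete {C : Type*} [Bicategory C]
    (F G : Pseudofunctor (LocallyDiscrete 𝒮) C) {A A' : LocallyDiscrete 𝒮} {f g : A ⟶ A'}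
    (η : f ⟶ g) (x : ∀ A, F.obj A ⟶ G.obj A)
    (n : ∀ f : A ⟶ A', F.map f ≫ x A' ≅ x A ≫ G.map f) :
    F.map₂ η ▷ x A' ≫ (n g).hom = (n f).hom ≫ x A ◁ G.map₂ η := by
  obtain rfl := LocallyDiscrete.eq_of_hom η
  obtain rfl : η = 𝟙 _ := Subsingleton.elim _ _
  simp

/-- The functor `F(f)`. -/
abbrev fmap (F : Pseudofunctor (LocallyDiscrete 𝒮) Cat.{v₂, u₂}) {A A' : 𝒮} (f : A ⟶ A') :
    F.obj ⟨A⟩ ⥤ F.obj ⟨A'⟩ := (F.map f.toLoc).toFunctor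

theorem fst_eqToHom {C D E : Cat.{v₂, u₂}} {G H : C ⟶ Cat.of (D × E)} (h : G = H) (X : C) :
    ((eqToHom h).toNatTrans.app X).1 =
      eqToHom (congrArg (fun K : C ⟶ Cat.of (D × E) => (K.toFunctor.obj X).1) h) := by
  subst h; rfl

theorem snd_eqToHom {C D E : Cat.{v₂, u₂}} {G H : C ⟶ Cat.of (D × E)} (h : G = H) (X : C) :
    ((eqToHom h).toNatTrans.app X).2 =
      eqToHom (congrArg (fun K : C ⟶ Cat.of (D × E) => (K.toFunctor.obj X).2) h) := by
  subst h; rfl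

theorem map₂_eq (F : Pseudofunctor (LocallyDiscrete 𝒮) Cat.{v₂, u₂})
    {A A' : LocallyDiscrete 𝒮} {f g : A ⟶ A'} (η : f ⟶ g) (X : F.obj A) :
    (F.map₂ η).toNatTrans.app X =
      eqToHom (by rw [LocallyDiscrete.eq_of_hom η]) := by
  obtain rfl := LocallyDiscrete.eq_of_hom η
  obtain rfl : η = 𝟙 _ := Subsingleton.elim _ _
  simp

/-- The pseudofunctor `𝒮 × 𝒮 ⟶ CAT × CAT ⟶ CAT`, `(A, B) ↦ F(A) × F(B)`. -/
def prodPseudo (F : Pseudofunctor (LocallyDiscrete 𝒮) Cat.{v₂, u₂}) :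
    Pseudofunctor (LocallyDiscrete (𝒮 × 𝒮)) Cat.{v₂, u₂} :=
  LocallyDiscrete.mkPseudofunctor
    (fun A => Cat.of (F.obj ⟨A.1⟩ × F.obj ⟨A.2⟩))
    (fun f => ((fmap F f.1).prod (fmap F f.2)).toCatHom)
    (fun A => Cat.Hom.isoMk (NatIso.prod (Cat.Hom.toNatIso (F.mapId ⟨A.1⟩))
      (Cat.Hom.toNatIso (F.mapId ⟨A.2⟩))))
    (fun f g => Cat.Hom.isoMk (NatIso.prod (Cat.Hom.toNatIso (F.mapComp f.1.toLoc g.1.toLoc))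
      (Cat.Hom.toNatIso (F.mapComp f.2.toLoc g.2.toLoc))))
    (fun f g h => by
      ext X
      apply Prod.ext
      · refine Eq.trans ?_ (fst_eqToHom _ X).symm
        refine Eq.trans ?_ (map₂_eq F (α_ f.1.toLoc g.1.toLoc h.1.toLoc).hom X.1)
        rw [F.map₂_associator]
        rfl
      · refine Eq.trans ?_ (snd_eqToHom _ X).symm
        refine Eq.trans ?_ (map₂_eq F (α_ f.2.toLoc g.2.toLoc h.2.toLoc).hom X.2)
        rw [F.map₂_associator]
        rfl)
    (fun f => by
      ext X
      apply Prod.ext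
      · refine Eq.trans ?_ (fst_eqToHom _ X).symm
        refine Eq.trans ?_ (map₂_eq F (λ_ f.1.toLoc).hom X.1)
        rw [F.map₂_left_unitor]
        rfl
      · refine Eq.trans ?_ (snd_eqToHom _ X).symm
        refine Eq.trans ?_ (map₂_eq F (λ_ f.2.toLoc).hom X.2)
        rw [F.map₂_left_unitor]
        rfl)
    (fun f => by
      ext X
      apply Prod.ext
      · refine Eq.trans ?_ (fst_eqToHom _ X).symm
        refine Eq.trans ?_ (map₂_eq F (ρ_ f.1.toLoc).hom X.1)
        rw [F.map₂_right_unitor]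
        rfl
      · refine Eq.trans ?_ (snd_eqToHom _ X).symm
        refine Eq.trans ?_ (map₂_eq F (ρ_ f.2.toLoc).hom X.2)
        rw [F.map₂_right_unitor]
        rfl)

/-- Pairing of natural isomorphisms. -/
def pairIso {C D E : Type*} [Category* C] [Category* D] [Category* E] {F F' : C ⥤ D} {G G' : C ⥤ E}
    (e : F ≅ F') (e' : G ≅ G') : F.prod' G ≅ F'.prod' G' where
  hom := NatTrans.prod' e.hom e'.hom
  inv := NatTrans.prod' e.inv e'.inv

end General
section
open MonoidalCategory CartesianMonoidalCategory
variable {𝒮 : Type u₁} [Category.{v₁} 𝒮]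
variable [CartesianMonoidalCategory 𝒮]

/-- The pseudofunctor `𝒮 × 𝒮 ⟶ 𝒮 ⟶ CAT`, `(A, B) ↦ F(A × B)`. -/
def tensorPseudo (F : Pseudofunctor (LocallyDiscrete 𝒮) Cat.{v₂, u₂}) :
    Pseudofunctor (LocallyDiscrete (𝒮 × 𝒮)) Cat.{v₂, u₂} :=
  (tensor 𝒮).toPseudofunctor.comp F

/-- The component `L^{A,B} = ⟨F(π₁), F(π₂)⟩ : F(A × B) ⥤ F(A) × F(B)`. -/
def LApp (F : Pseudofunctor (LocallyDiscrete 𝒮) Cat.{v₂, u₂}) (A : LocallyDiscrete (𝒮 × 𝒮)) :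
    (tensorPseudo F).obj A ⟶ (prodPseudo F).obj A :=
  (Functor.prod' (fmap F (fst A.as.1 A.as.2)) (fmap F (snd A.as.1 A.as.2))).toCatHom

/-- The invertible 2-cell `L^{(a,b)}`, whose two components are the coherence isomorphisms of `F`
at the commutative squares `(a × b) ≫ π₁ = π₁ ≫ a` and `(a × b) ≫ π₂ = π₂ ≫ b`. -/
def LNat (F : Pseudofunctor (LocallyDiscrete 𝒮) Cat.{v₂, u₂}) {A A' : LocallyDiscrete (𝒮 × 𝒮)}
    (f : A ⟶ A') : (tensorPseudo F).map f ≫ LApp F A' ≅ LApp F A ≫ (prodPseudo F).map f :=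
  Cat.Hom.isoMk (pairIso
      (Cat.Hom.toNatIso (F.isoMapOfCommSq
        (CommSq.toLoc (t := f.as.1 ⊗ₘ f.as.2) (l := fst A.as.1 A.as.2)
          (r := fst A'.as.1 A'.as.2) (b := f.as.1) ⟨by simp⟩)))
      (Cat.Hom.toNatIso (F.isoMapOfCommSq
        (CommSq.toLoc (t := f.as.1 ⊗ₘ f.as.2) (l := snd A.as.1 A.as.2)
          (r := snd A'.as.1 A'.as.2) (b := f.as.2) ⟨by simp⟩))))

/-- The pseudonatural transformation `L`, with components `L^{A,B} = ⟨F(π₁), F(π₂)⟩`. -/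
def L (F : Pseudofunctor (LocallyDiscrete 𝒮) Cat.{v₂, u₂}) :
    Pseudofunctor.StrongTrans (tensorPseudo F) (prodPseudo F) where
  app A := LApp F A
  naturality f := LNat F f
  naturality_naturality η :=
    naturality_of_locallyDiscrete (tensorPseudo F) (prodPseudo F) η (LApp F) (fun f => LNat F f)
  naturality_id A := by
    ext X
    apply Prod.ext
    · exact congrArg (fun t => t.toNatTrans.app X) (isoMapOfCommSq_id F
        (t := ((𝟙 A.as.1) ⊗ₘ (𝟙 A.as.2)).toLoc) (by rw [id_tensorHom_id]; rfl)
        (p := (fst A.as.1 A.as.2).toLoc)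
        (CommSq.toLoc (b := 𝟙 A.as.1) ⟨by simp⟩))
    · exact congrArg (fun t => t.toNatTrans.app X) (isoMapOfCommSq_id F
        (t := ((𝟙 A.as.1) ⊗ₘ (𝟙 A.as.2)).toLoc) (by rw [id_tensorHom_id]; rfl)
        (p := (snd A.as.1 A.as.2).toLoc)
        (CommSq.toLoc (b := 𝟙 A.as.2) ⟨by simp⟩))
  naturality_comp {A A' A''} f g := by
    ext X
    apply Prod.ext
    · exact congrArg (fun t => t.toNatTrans.app X) (isoMapOfCommSq_comp' F
        (f := (f.as.1 ⊗ₘ f.as.2).toLoc) (g := (g.as.1 ⊗ₘ g.as.2).toLoc)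
        (fg := ((f.as.1 ≫ g.as.1) ⊗ₘ (f.as.2 ≫ g.as.2)).toLoc) (by simp [← Quiver.Hom.comp_toLoc])
        (f' := f.as.1.toLoc) (g' := g.as.1.toLoc)
        (p := (fst A.as.1 A.as.2).toLoc) (q := (fst A'.as.1 A'.as.2).toLoc)
        (r := (fst A''.as.1 A''.as.2).toLoc)
        (CommSq.toLoc ⟨by simp⟩) (CommSq.toLoc ⟨by simp⟩)
        (CommSq.toLoc (b := f.as.1 ≫ g.as.1) ⟨by simp⟩))
    · exact congrArg (fun t => t.toNatTrans.app X) (isoMapOfCommSq_comp' F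
        (f := (f.as.1 ⊗ₘ f.as.2).toLoc) (g := (g.as.1 ⊗ₘ g.as.2).toLoc)
        (fg := ((f.as.1 ≫ g.as.1) ⊗ₘ (f.as.2 ≫ g.as.2)).toLoc) (by simp [← Quiver.Hom.comp_toLoc])
        (f' := f.as.2.toLoc) (g' := g.as.2.toLoc)
        (p := (snd A.as.1 A.as.2).toLoc) (q := (snd A'.as.1 A'.as.2).toLoc)
        (r := (snd A''.as.1 A''.as.2).toLoc)
        (CommSq.toLoc ⟨by simp⟩) (CommSq.toLoc ⟨by simp⟩)
        (CommSq.toLoc (b := f.as.2 ≫ g.as.2) ⟨by simp⟩))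

/-- The pseudofunctor `𝟙 ⟶ CAT` on the terminal 2-category whose value is the terminal category. -/
def unitPseudo : Pseudofunctor (LocallyDiscrete (Discrete PUnit.{1})) Cat.{v₂, u₂} :=
  ((Functor.const (Discrete PUnit.{1})).obj (Cat.chosenTerminal.{v₂, u₂})).toPseudofunctor'

/-- The pseudofunctor `𝟙 ⟶ 𝒮 ⟶ CAT` whose value is `F(I)`, for `I` the terminal object of `𝒮`. -/
def pointPseudo (F : Pseudofunctor (LocallyDiscrete 𝒮) Cat.{v₂, u₂}) :
    Pseudofunctor (LocallyDiscrete (Discrete PUnit.{1})) Cat.{v₂, u₂} :=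
  (Functor.fromPUnit (𝟙_ 𝒮)).toPseudofunctor.comp F

theorem terminal_hom_ext {X Y : Cat.chosenTerminal.{v₂, u₂}} (f g : X ⟶ Y) : f = g :=
 by
  rcases f with ⟨f⟩; rcases g with ⟨g⟩
  exact congrArg _ (Subsingleton.elim _ _)

/-- The pseudonatural transformation `L¹`, whose component is the functor `F(I) ⥤ 𝖨`. -/
def L1 (F : Pseudofunctor (LocallyDiscrete 𝒮) Cat.{v₂, u₂}) :
    Pseudofunctor.StrongTrans (pointPseudo F) unitPseudo where
  app _ := Cat.chosenTerminalIsTerminal.from _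
  naturality f := Iso.refl _
  naturality_naturality _ := by ext X; exact terminal_hom_ext _ _
  naturality_id _ := by ext X; exact terminal_hom_ext _ _
  naturality_comp _ _ := by ext X; exact terminal_hom_ext _ _

end

/-! ### Lax symmetric monoidal structures -/

section LaxMonoidal

open MonoidalCategory CartesianMonoidalCategory

variable {𝒮 : Type u₁} [Category.{v₁} 𝒮] [CartesianMonoidalCategory 𝒮]

/-- The braiding `σ : A × B ⟶ B × A` of the cartesian structure. -/
def swap (A B : 𝒮) : A ⊗ B ⟶ B ⊗ A := lift (snd A B) (fst A B)

section

variable {F : Pseudofunctor (LocallyDiscrete 𝒮) Cat.{v₂, u₂}}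

/-- The component `φ¹ : F(1) ⟶ 1` of the coherence isomorphism of `F` at an identity. -/
def unitCell {A : 𝒮} (X : F.obj ⟨A⟩) : (fmap F (𝟙 A)).obj X ⟶ X :=
  (F.mapId ⟨A⟩).hom.toNatTrans.app X

/-- The pasting of two cells along the coherence isomorphism `F(f ≫ g) ≅ F(f) ⋙ F(g)`: an arrow
`u : f_* X ⟶ Y` followed by an arrow `v : g_* Y ⟶ Z`. -/
def paste {A A' A'' : 𝒮} {f : A ⟶ A'} {g : A' ⟶ A''} {k : A ⟶ A''} (h : f ≫ g = k)
    {X : F.obj ⟨A⟩} {Y : F.obj ⟨A'⟩} {Z : F.obj ⟨A''⟩}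
    (u : (fmap F f).obj X ⟶ Y) (v : (fmap F g).obj Y ⟶ Z) : (fmap F k).obj X ⟶ Z :=
  (F.mapComp' f.toLoc g.toLoc k.toLoc (by rw [← h]; rfl)).hom.toNatTrans.app X ≫
    (fmap F g).map u ≫ v

variable (R : Pseudofunctor.StrongTrans (prodPseudo F) (tensorPseudo F))
  (R1 : Pseudofunctor.StrongTrans unitPseudo (pointPseudo F))

/-- The component `R^{A,B} : F(A) × F(B) ⥤ F(A × B)`. -/
abbrev tensorFunctor (A B : 𝒮) : F.obj ⟨A⟩ × F.obj ⟨B⟩ ⥤ F.obj ⟨A ⊗ B⟩ :=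
  (R.app ⟨(A, B)⟩).toFunctor

/-- The object `R^{A,B}(X, Y)`. -/
abbrev tens {A B : 𝒮} (X : F.obj ⟨A⟩) (Y : F.obj ⟨B⟩) : F.obj ⟨A ⊗ B⟩ :=
  (tensorFunctor R A B).obj (X, Y)

/-- The only object `⋆` of the terminal category. -/
def star : Cat.chosenTerminal.{v₂, u₂} := ⟨⟨⟨⟩⟩⟩

/-- The functor `R¹ : 𝖨 ⥤ F(I)`. -/
abbrev unitFunctor : Cat.chosenTerminal.{v₂, u₂} ⥤ F.obj ⟨𝟙_ 𝒮⟩ :=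
  (R1.app ⟨⟨⟨⟩⟩⟩).toFunctor

/-- The object `R¹(⋆)`. -/
abbrev unitObj : F.obj ⟨𝟙_ 𝒮⟩ := (unitFunctor R1).obj star

/-- The component `R^{(a,b)} : (a × b)_* R(X, Y) ⟶ R(a_* X, b_* Y)` of the pseudonatural
transformation `R` at the pair of arrows `(a, b)`. -/
def comparison {A A' B B' : 𝒮} (a : A ⟶ A') (b : B ⟶ B') (X : F.obj ⟨A⟩) (Y : F.obj ⟨B⟩) :
    (fmap F (a ⊗ₘ b)).obj (tens R X Y) ⟶ tens R ((fmap F a).obj X) ((fmap F b).obj Y) :=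
  (R.naturality (Quiver.Hom.toLoc ((a, b) : (A, B) ⟶ (A', B')))).inv.toNatTrans.app (X, Y)

/-- The tensor product `(a × b)_* R(X, Y) ⟶ R(a_* X, b_* Y) ⟶ R(X', Y')` of two cells
`u : a_* X ⟶ X'` and `v : b_* Y ⟶ Y'`. -/
def tensorCell {A A' B B' : 𝒮} (a : A ⟶ A') (b : B ⟶ B') {X : F.obj ⟨A⟩} {X' : F.obj ⟨A'⟩}
    {Y : F.obj ⟨B⟩} {Y' : F.obj ⟨B'⟩} (u : (fmap F a).obj X ⟶ X') (v : (fmap F b).obj Y ⟶ Y') :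
    (fmap F (a ⊗ₘ b)).obj (tens R X Y) ⟶ tens R X' Y' :=
  comparison R a b X Y ≫ (tensorFunctor R A' B').map ((u, v) : (_, _) ⟶ (_, _))

end

/-- A lax symmetric monoidal structure on the pseudofunctor `F : (𝒮, ×, I) ⟶ (CAT, ×, 𝖨)`. The
axioms are the equations of pasting diagrams that define invertible modifications and their
coherence, evaluated at objects of the categories `F(A)`. -/
structure LaxSymmetricMonoidal (F : Pseudofunctor (LocallyDiscrete 𝒮) Cat.{v₂, u₂}) where
  /-- The pseudonatural transformation with components `F(A) × F(B) ⥤ F(A × B)`. -/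
  R : Pseudofunctor.StrongTrans (prodPseudo F) (tensorPseudo F)
  /-- The pseudonatural transformation with component `𝖨 ⥤ F(I)`. -/
  R1 : Pseudofunctor.StrongTrans unitPseudo (pointPseudo F)
  /-- The associativity modification. -/
  ω (A B C : 𝒮) :
    (tensorFunctor R A B).prod (𝟭 (F.obj ⟨C⟩)) ⋙ tensorFunctor R (A ⊗ B) C ⋙
        fmap F (α_ A B C).hom ≅
      prod.associator (F.obj ⟨A⟩) (F.obj ⟨B⟩) (F.obj ⟨C⟩) ⋙
        (𝟭 (F.obj ⟨A⟩)).prod (tensorFunctor R B C) ⋙ tensorFunctor R A (B ⊗ C)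
  /-- The right unit modification. -/
  ζ (A : 𝒮) :
    (𝟭 (F.obj ⟨A⟩)).prod (unitFunctor R1) ⋙ tensorFunctor R A (𝟙_ 𝒮) ⋙
        fmap F (fst A (𝟙_ 𝒮)) ≅
      CategoryTheory.Prod.fst (F.obj ⟨A⟩) Cat.chosenTerminal.{v₂, u₂}
  /-- The left unit modification. -/
  ξ (A : 𝒮) :
    (unitFunctor R1).prod (𝟭 (F.obj ⟨A⟩)) ⋙ tensorFunctor R (𝟙_ 𝒮) A ⋙
        fmap F (snd (𝟙_ 𝒮) A) ≅
      CategoryTheory.Prod.snd Cat.chosenTerminal.{v₂, u₂} (F.obj ⟨A⟩)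
  /-- The symmetry modification. -/
  θ (A B : 𝒮) :
    tensorFunctor R A B ⋙ fmap F (swap A B) ≅
      CategoryTheory.Prod.swap (F.obj ⟨A⟩) (F.obj ⟨B⟩) ⋙ tensorFunctor R B A
  ω_modification {A A' B B' C C' : 𝒮} (a : A ⟶ A') (b : B ⟶ B') (c : C ⟶ C')
    (X : F.obj ⟨A⟩) (Y : F.obj ⟨B⟩) (Z : F.obj ⟨C⟩) :
    paste (k := (α_ A B C).hom ≫ (a ⊗ₘ (b ⊗ₘ c))) (associator_naturality a b c)
        (tensorCell R (a ⊗ₘ b) c (comparison R a b X Y) (𝟙 ((fmap F c).obj Z)))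
        ((ω A' B' C').hom.app (((fmap F a).obj X, (fmap F b).obj Y), (fmap F c).obj Z)) =
      paste rfl ((ω A B C).hom.app ((X, Y), Z))
        (tensorCell R a (b ⊗ₘ c) (𝟙 ((fmap F a).obj X)) (comparison R b c Y Z))
  ζ_modification {A A' : 𝒮} (a : A ⟶ A') (X : F.obj ⟨A⟩) :
    paste (k := fst A (𝟙_ 𝒮) ≫ a) (tensorHom_fst a (𝟙 (𝟙_ 𝒮)))
        (tensorCell R a (𝟙 (𝟙_ 𝒮)) (𝟙 ((fmap F a).obj X)) (unitCell (unitObj R1)))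
        ((ζ A').hom.app ((fmap F a).obj X, star)) =
      paste rfl ((ζ A).hom.app (X, star)) (𝟙 ((fmap F a).obj X))
  ξ_modification {A A' : 𝒮} (a : A ⟶ A') (X : F.obj ⟨A⟩) :
    paste (k := snd (𝟙_ 𝒮) A ≫ a) (tensorHom_snd (𝟙 (𝟙_ 𝒮)) a)
        (tensorCell R (𝟙 (𝟙_ 𝒮)) a (unitCell (unitObj R1)) (𝟙 ((fmap F a).obj X)))
        ((ξ A').hom.app (star, (fmap F a).obj X)) =
      paste rfl ((ξ A).hom.app (star, X)) (𝟙 ((fmap F a).obj X))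
  θ_modification {A A' B B' : 𝒮} (a : A ⟶ A') (b : B ⟶ B') (X : F.obj ⟨A⟩) (Y : F.obj ⟨B⟩) :
    paste (k := swap A B ≫ (b ⊗ₘ a)) (by simp [swap])
        (comparison R a b X Y)
        ((θ A' B').hom.app ((fmap F a).obj X, (fmap F b).obj Y)) =
      paste rfl ((θ A B).hom.app (X, Y)) (comparison R b a Y X)
  /-- The associativity coherence, from `((W X) Y) Z` to `W (X (Y Z))`. -/
  pentagon {A B C D : 𝒮} (W : F.obj ⟨A⟩) (X : F.obj ⟨B⟩) (Y : F.obj ⟨C⟩) (Z : F.obj ⟨D⟩) :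
    paste (k := (α_ (A ⊗ B) C D).hom ≫ (α_ A B (C ⊗ D)).hom)
        (by simp)
        (tensorCell R (α_ A B C).hom (𝟙 D) ((ω A B C).hom.app ((W, X), Y)) (unitCell Z))
        (paste (k := (α_ A (B ⊗ C) D).hom ≫ (𝟙 A ⊗ₘ (α_ B C D).hom)) rfl
          ((ω A (B ⊗ C) D).hom.app ((W, tens R X Y), Z))
          (tensorCell R (𝟙 A) (α_ B C D).hom (unitCell W) ((ω B C D).hom.app ((X, Y), Z)))) =
      paste rfl ((ω (A ⊗ B) C D).hom.app ((tens R W X, Y), Z))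
        ((ω A B (C ⊗ D)).hom.app ((W, X), tens R Y Z))
  /-- The unit coherence, from `(X ⋆) Y` to `X Y`. -/
  triangle {A B : 𝒮} (X : F.obj ⟨A⟩) (Y : F.obj ⟨B⟩) :
    tensorCell R (fst A (𝟙_ 𝒮)) (𝟙 B) ((ζ A).hom.app (X, star)) (unitCell Y) =
      paste (by ext <;> simp) ((ω A (𝟙_ 𝒮) B).hom.app ((X, unitObj R1), Y))
        (tensorCell R (𝟙 A) (snd (𝟙_ 𝒮) B) (unitCell X) ((ξ B).hom.app (star, Y)))
  /-- The coherence of the symmetry with associativity, from `(X Y) Z` to `Y (Z X)`. -/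
  hexagon {A B C : 𝒮} (X : F.obj ⟨A⟩) (Y : F.obj ⟨B⟩) (Z : F.obj ⟨C⟩) :
    paste (k := (swap A B ⊗ₘ 𝟙 C) ≫ (α_ B A C).hom ≫ (𝟙 B ⊗ₘ swap A C))
        (by ext <;> simp [swap])
        ((ω A B C).hom.app ((X, Y), Z))
        (paste (k := swap A (B ⊗ C) ≫ (α_ B C A).hom) rfl
          ((θ A (B ⊗ C)).hom.app (X, tens R Y Z))
          ((ω B C A).hom.app ((Y, Z), X))) =
      paste rfl (tensorCell R (swap A B) (𝟙 C) ((θ A B).hom.app (X, Y)) (unitCell Z))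
        (paste (k := (α_ B A C).hom ≫ (𝟙 B ⊗ₘ swap A C)) rfl
          ((ω B A C).hom.app ((Y, X), Z))
          (tensorCell R (𝟙 B) (swap A C) (unitCell Y) ((θ A C).hom.app (X, Z))))
  symmetry {A B : 𝒮} (X : F.obj ⟨A⟩) (Y : F.obj ⟨B⟩) :
    paste (k := 𝟙 (A ⊗ B)) (by ext <;> simp [swap])
        ((θ A B).hom.app (X, Y)) ((θ B A).hom.app (Y, X)) =
      unitCell (tens R X Y)

end LaxMonoidal

/-! ### Conditions on an opfibration -/

section Conditions

open MonoidalCategory CartesianMonoidalCategory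

variable {𝒮 : Type u₁} [Category.{v₁} 𝒮] [CartesianMonoidalCategory 𝒮]
  {𝒳 : Type u₂} [Category.{v₂} 𝒳]

/-- For chosen finite products on `𝒳` and `𝒮`, the functor `P` is strict monoidal for the
cartesian structures and the product of two cocartesian arrows is cocartesian. Equality of arrows
of `𝒮` up to the equalities of their domains and codomains is expressed by `IsHomLift`:
`P.IsHomLift f φ` says that `P.map φ` is `f`. -/
structure IsCartesianMonoidalOpfibration [CartesianMonoidalCategory 𝒳] (P : 𝒳 ⥤ 𝒮) : Prop where
  obj_unit : P.obj (𝟙_ 𝒳) = 𝟙_ 𝒮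
  obj_tensor (X Y : 𝒳) : P.obj (X ⊗ Y) = P.obj X ⊗ P.obj Y
  map_tensor {X X' Y Y' : 𝒳} (φ : X ⟶ X') (ψ : Y ⟶ Y') :
    P.IsHomLift (P.map φ ⊗ₘ P.map ψ) (φ ⊗ₘ ψ)
  map_associator (X Y Z : 𝒳) :
    P.IsHomLift (α_ (P.obj X) (P.obj Y) (P.obj Z)).hom (α_ X Y Z).hom
  map_leftUnitor (X : 𝒳) : P.IsHomLift (λ_ (P.obj X)).hom (λ_ X).hom
  map_rightUnitor (X : 𝒳) : P.IsHomLift (ρ_ (P.obj X)).hom (ρ_ X).hom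
  tensor_cocartesian {A A' B B' : 𝒮} {X X' Y Y' : 𝒳} (f : A ⟶ A') (g : B ⟶ B') (φ : X ⟶ X')
    (ψ : Y ⟶ Y') : P.IsStronglyCocartesian f φ → P.IsStronglyCocartesian g ψ →
      P.IsStronglyCocartesian (f ⊗ₘ g) (φ ⊗ₘ ψ)

section

open scoped Pseudofunctor.StrongTrans

/-- `L` has a right adjoint in the 2-category of pseudofunctors `𝒮 × 𝒮 ⟶ CAT`, pseudonatural
transformations and modifications. -/
def LHasRightAdjoint (F : Pseudofunctor (LocallyDiscrete 𝒮) Cat.{v₂, u₂}) : Prop :=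
  Bicategory.IsLeftAdjoint (a := tensorPseudo F) (b := prodPseudo F) (L F)

/-- `L¹` has a right adjoint in the 2-category of pseudofunctors `𝟙 ⟶ CAT`, pseudonatural
transformations and modifications. -/
def L1HasRightAdjoint (F : Pseudofunctor (LocallyDiscrete 𝒮) Cat.{v₂, u₂}) : Prop :=
  Bicategory.IsLeftAdjoint (a := pointPseudo F) (b := unitPseudo.{v₂, u₂}) (L1 F)

end

variable {P : 𝒳 ⥤ 𝒮}

/-- `R(X, Y) = X × Y`: the object `R^{A,B}(X, Y)`, with projections lying over those of `A × B`,
is a product of `X` and `Y` in `𝒳`, and through these projections `R` is the product on arrows,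
both on vertical arrows, `R(u, v) = u × v`, and on cocartesian liftings, in that `R^{(a,b)}` is the
comparison between the cocartesian lifting of `a × b` and the product of those of `a` and `b`. -/
structure TensorIsProduct (c : Cleavage P)
    (R : Pseudofunctor.StrongTrans (prodPseudo c.pseudofunctor) (tensorPseudo c.pseudofunctor)) where
  /-- The first projection. -/
  p₁ {A B : 𝒮} (X : P.Fiber A) (Y : P.Fiber B) :
    incl.obj (tens R (A := A) (B := B) X Y : P.Fiber (A ⊗ B)) ⟶ incl.obj X
  /-- The second projection. -/
  p₂ {A B : 𝒮} (X : P.Fiber A) (Y : P.Fiber B) :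
    incl.obj (tens R (A := A) (B := B) X Y : P.Fiber (A ⊗ B)) ⟶ incl.obj Y
  p₁_over {A B : 𝒮} (X : P.Fiber A) (Y : P.Fiber B) : P.IsHomLift (fst A B) (p₁ X Y)
  p₂_over {A B : 𝒮} (X : P.Fiber A) (Y : P.Fiber B) : P.IsHomLift (snd A B) (p₂ X Y)
  isProduct {A B : 𝒮} (X : P.Fiber A) (Y : P.Fiber B) :
    Nonempty (Limits.IsLimit (Limits.BinaryFan.mk (p₁ X Y) (p₂ X Y)))
  map_p₁ {A B : 𝒮} {X X' : P.Fiber A} {Y Y' : P.Fiber B} (u : X ⟶ X') (v : Y ⟶ Y') :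
    incl.map (X := (tens R (A := A) (B := B) X Y : P.Fiber (A ⊗ B)))
        ((tensorFunctor R A B).map ((u, v) : (X, Y) ⟶ (X', Y'))) ≫ p₁ X' Y' =
      p₁ X Y ≫ incl.map u
  map_p₂ {A B : 𝒮} {X X' : P.Fiber A} {Y Y' : P.Fiber B} (u : X ⟶ X') (v : Y ⟶ Y') :
    incl.map (X := (tens R (A := A) (B := B) X Y : P.Fiber (A ⊗ B)))
        ((tensorFunctor R A B).map ((u, v) : (X, Y) ⟶ (X', Y'))) ≫ p₂ X' Y' =
      p₂ X Y ≫ incl.map v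
  comparison_p₁ {A A' B B' : 𝒮} (a : A ⟶ A') (b : B ⟶ B') (X : P.Fiber A) (Y : P.Fiber B) :
    c.lift (a ⊗ₘ b) (tens R (A := A) (B := B) X Y) ≫
        incl.map (X := c.obj (a ⊗ₘ b) (tens R (A := A) (B := B) X Y))
          (comparison R a b X Y) ≫ p₁ (c.obj a X) (c.obj b Y) =
      p₁ X Y ≫ c.lift a X
  comparison_p₂ {A A' B B' : 𝒮} (a : A ⟶ A') (b : B ⟶ B') (X : P.Fiber A) (Y : P.Fiber B) :
    c.lift (a ⊗ₘ b) (tens R (A := A) (B := B) X Y) ≫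
        incl.map (X := c.obj (a ⊗ₘ b) (tens R (A := A) (B := B) X Y))
          (comparison R a b X Y) ≫ p₂ (c.obj a X) (c.obj b Y) =
      p₂ X Y ≫ c.lift b Y

/-- `R¹(⋆) = I`: the object `R¹(⋆)` is terminal in `𝒳`. -/
def UnitIsTerminal (c : Cleavage P)
    (R1 : Pseudofunctor.StrongTrans unitPseudo (pointPseudo c.pseudofunctor)) : Prop :=
  Nonempty (Limits.IsTerminal (incl.obj (unitObj R1 : P.Fiber (𝟙_ 𝒮))))

end Conditions

end CartOpfib

/-! A vertical arrow `f_* X ⟶ Y` is the same thing as an arrow `X ⟶ Y` over `f`: compose with the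
lifting (`total`), and go back by its universal property (`descend`, `total_injective`). In this
dictionary pasting of 2-cells becomes composition (`total_paste`) and the unit cells of `F` become
identities (`total_unitCell`), so an equation of 2-cells of `CAT` becomes an equation of arrows of
`𝒳`.

(i) implies (iii). The product of `𝒳` restricts to functors `F(A) × F(B) ⥤ F(A × B)`. Since products
of liftings are cocartesian, the comparison `(a × b)_* (X × Y) ⟶ a_* X × b_* Y` is invertible, which
is pseudonaturality. The associator, unitors and symmetry of `𝒳` are isomorphisms over those of `𝒮`,
hence cocartesian, hence give invertible modifications. Through `total` each axiom is naturality or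
coherence of the cartesian structure of `𝒳`.

(i) implies (ii). For `Z` over `A × B`, a vertical arrow `Z ⟶ X × Y` is a pair of arrows `Z ⟶ X`, `Z
⟶ Y` over the two projections, that is, a pair of vertical arrows out of `(π₁)_* Z` and `(π₂)_* Z`.
So `⟨F(π₁), F(π₂)⟩` is left adjoint to the product; its unit pairs the liftings of the projections
and its counit consists of the vertical parts of the projections of `X × Y`.

(ii) implies (i). The adjunction gives the universal property of `R(X, Y)` for vertical arrows only.
Pushing a test object forward along `⟨f, g⟩` extends it to arrows over arbitrary `f` and `g`
(`exists_pairing`, `pairing_ext`), and pushing it forward to `I` does the same for the terminal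
object. As the counit is a modification, `R^{(a,b)}` is the comparison with the product of liftings
(`total_comparison_comp₁`, `total_comparison_comp₂`); it is invertible, so that product is
cocartesian.

(iii) implies (i). The products are part of the data, and the invertibility of `R^{(a,b)}` again
makes products of liftings cocartesian. Both returns to (i) pass through `LiftedProducts`. -/

namespace CartOpfib

open MonoidalCategory CartesianMonoidalCategory Functor

/-! ### Arrows of the total category and the arrows of the base below them -/

section Lifts

variable {𝒮 : Type u₁} [Category.{v₁} 𝒮] {𝒳 : Type u₂} [Category.{v₂} 𝒳] {P : 𝒳 ⥤ 𝒮}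

theorem isHomLift_unique {A A' : 𝒮} {X X' : 𝒳} {f g : A ⟶ A'} (φ : X ⟶ X')
    (hf : P.IsHomLift f φ) (hg : P.IsHomLift g φ) : f = g :=
  (IsHomLift.fac P f φ).trans (IsHomLift.fac P g φ).symm

theorem exists_isHomLift {A A' : 𝒮} {X X' : 𝒳} (φ : X ⟶ X') (h : P.obj X = A)
    (h' : P.obj X' = A') : ∃ f : A ⟶ A', P.IsHomLift f φ := by
  subst h h'; exact ⟨_, IsHomLift.map P φ⟩

theorem isHomLift_congr {A A' : 𝒮} {X X' : 𝒳} {f g : A ⟶ A'} {φ : X ⟶ X'} (h : f = g)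
    (hf : P.IsHomLift f φ) : P.IsHomLift g φ := h ▸ hf

/-- Strong cocartesianness allows cancellation among arrows over any common `g`, not only among
vertical ones; this is needed with `g` a projection of the base. -/
theorem eq_of_cocartesian_comp {A A' A'' : 𝒮} {X Y Z : 𝒳} {f : A ⟶ A'} {g : A' ⟶ A''}
    {φ : X ⟶ Y} (hφ : P.IsStronglyCocartesian f φ) {ψ ψ' : Y ⟶ Z} (hψ : P.IsHomLift g ψ)
    (hψ' : P.IsHomLift g ψ') (h : φ ≫ ψ = φ ≫ ψ') : ψ = ψ' :=
  IsStronglyCocartesian.ext P f φ g h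

variable [CartesianMonoidalCategory 𝒮]

/-- An arrow into an object over a product lies over the pairing of the arrows below its
projections. -/
theorem isHomLift_lift {A B C : 𝒮} {X Y Z W : 𝒳} {p : Z ⟶ X} {q : Z ⟶ Y}
    (hp : P.IsHomLift (fst A B) p) (hq : P.IsHomLift (snd A B) q) {f : C ⟶ A} {g : C ⟶ B}
    (φ : W ⟶ Z) (hf : P.IsHomLift f (φ ≫ p)) (hg : P.IsHomLift g (φ ≫ q)) :
    P.IsHomLift (lift f g) φ := by
  -- The ends of `φ` lie over `C` and `A ⊗ B`, so `φ` lies over some `m`, which is then determined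
  -- by its two composites with the projections.
  obtain ⟨m, hm⟩ := exists_isHomLift (P := P) φ (IsHomLift.domain_eq P f (φ ≫ p))
    (IsHomLift.domain_eq P (fst A B) p)
  refine isHomLift_congr ?_ hm
  apply CartesianMonoidalCategory.hom_ext
  · rw [lift_fst]; exact isHomLift_unique (φ ≫ p) inferInstance hf
  · rw [lift_snd]; exact isHomLift_unique (φ ≫ q) inferInstance hg

theorem isHomLift_toUnit {C : 𝒮} {W Z : 𝒳} (hW : P.obj W = C) (hZ : P.obj Z = 𝟙_ 𝒮) (φ : W ⟶ Z) :
    P.IsHomLift (toUnit C) φ := by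
  obtain ⟨m, hm⟩ := exists_isHomLift (P := P) φ hW hZ
  exact isHomLift_congr (toUnit_unique _ _) hm

end Lifts

/-! ### Products in the total category lying over those of the base -/

section Products

variable {𝒮 : Type u₁} [Category.{v₁} 𝒮] [CartesianMonoidalCategory 𝒮]
  {𝒳 : Type u₂} [Category.{v₂} 𝒳] {P : 𝒳 ⥤ 𝒮}

/-- A choice of finite products over those of the base is strict monoidal. -/
theorem IsCartesianMonoidalOpfibration.of_projections [CartesianMonoidalCategory 𝒳]
    (hI : P.obj (𝟙_ 𝒳) = 𝟙_ 𝒮)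
    (h₁ : ∀ X Y : 𝒳, P.IsHomLift (fst (P.obj X) (P.obj Y)) (fst X Y))
    (h₂ : ∀ X Y : 𝒳, P.IsHomLift (snd (P.obj X) (P.obj Y)) (snd X Y))
    (hc : ∀ {A A' B B' : 𝒮} {X X' Y Y' : 𝒳} (f : A ⟶ A') (g : B ⟶ B') (φ : X ⟶ X')
      (ψ : Y ⟶ Y'), P.IsStronglyCocartesian f φ → P.IsStronglyCocartesian g ψ →
        P.IsStronglyCocartesian (f ⊗ₘ g) (φ ⊗ₘ ψ)) :
    IsCartesianMonoidalOpfibration P where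
  obj_unit := hI
  obj_tensor X Y := IsHomLift.domain_eq P (fst (P.obj X) (P.obj Y)) (fst X Y)
  map_tensor {X X' Y Y'} φ ψ := by
    refine isHomLift_congr (CartesianMonoidalCategory.hom_ext _ _ (by simp) (by simp))
      (isHomLift_lift (h₁ X' Y') (h₂ X' Y') (f := fst _ _ ≫ P.map φ) (g := snd _ _ ≫ P.map ψ)
        (φ ⊗ₘ ψ) ?_ ?_)
    · rw [tensorHom_fst]; infer_instance
    · rw [tensorHom_snd]; infer_instance
  map_associator X Y Z := by
    have hXY : P.obj (X ⊗ Y) = P.obj X ⊗ P.obj Y :=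
      IsHomLift.domain_eq P (fst (P.obj X) (P.obj Y)) (fst X Y)
    have hYZ : P.obj (Y ⊗ Z) = P.obj Y ⊗ P.obj Z :=
      IsHomLift.domain_eq P (fst (P.obj Y) (P.obj Z)) (fst Y Z)
    -- `P.obj (X ⊗ Y)` equals `P.obj X ⊗ P.obj Y` only propositionally, so the projections of
    -- iterated products are transported to the base objects that the associator mentions.
    have k₁ : P.IsHomLift (fst (P.obj X ⊗ P.obj Y) (P.obj Z)) (fst (X ⊗ Y) Z) := hXY ▸ h₁ (X ⊗ Y) Z
    have k₂ : P.IsHomLift (snd (P.obj X ⊗ P.obj Y) (P.obj Z)) (snd (X ⊗ Y) Z) := hXY ▸ h₂ (X ⊗ Y) Z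
    have l₁ : P.IsHomLift (fst (P.obj X) (P.obj Y ⊗ P.obj Z)) (fst X (Y ⊗ Z)) := hYZ ▸ h₁ X (Y ⊗ Z)
    have l₂ : P.IsHomLift (snd (P.obj X) (P.obj Y ⊗ P.obj Z)) (snd X (Y ⊗ Z)) := hYZ ▸ h₂ X (Y ⊗ Z)
    refine isHomLift_congr (CartesianMonoidalCategory.hom_ext _ _ ?_ ?_)
      (isHomLift_lift l₁ l₂ (f := fst _ _ ≫ fst _ _) (g := lift (fst _ _ ≫ snd _ _) (snd _ _))
        (α_ X Y Z).hom ?_ (isHomLift_lift (h₁ Y Z) (h₂ Y Z) _ ?_ ?_))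
    · simp
    · ext <;> simp
    · rw [associator_hom_fst]; infer_instance
    · rw [Category.assoc, associator_hom_snd_fst]; infer_instance
    · rw [Category.assoc, associator_hom_snd_snd]; infer_instance
  map_leftUnitor X := by
    rw [leftUnitor_hom, leftUnitor_hom]; exact hI ▸ h₂ (𝟙_ 𝒳) X
  map_rightUnitor X := by
    rw [rightUnitor_hom, rightUnitor_hom]; exact hI ▸ h₁ X (𝟙_ 𝒳)
  tensor_cocartesian := hc

/-- Finite products in the total category of an opfibration, over those of the base, such that
products of the chosen liftings are cocartesian. -/
structure LiftedProducts (c : Cleavage P) where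
  tens {A B : 𝒮} (X : P.Fiber A) (Y : P.Fiber B) : P.Fiber (A ⊗ B)
  p₁ {A B : 𝒮} (X : P.Fiber A) (Y : P.Fiber B) : incl.obj (tens X Y) ⟶ incl.obj X
  p₂ {A B : 𝒮} (X : P.Fiber A) (Y : P.Fiber B) : incl.obj (tens X Y) ⟶ incl.obj Y
  p₁_over {A B : 𝒮} (X : P.Fiber A) (Y : P.Fiber B) : P.IsHomLift (fst A B) (p₁ X Y)
  p₂_over {A B : 𝒮} (X : P.Fiber A) (Y : P.Fiber B) : P.IsHomLift (snd A B) (p₂ X Y)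
  isLimit {A B : 𝒮} (X : P.Fiber A) (Y : P.Fiber B) :
    Limits.IsLimit (Limits.BinaryFan.mk (p₁ X Y) (p₂ X Y))
  unit : P.Fiber (𝟙_ 𝒮)
  isTerminal : Limits.IsTerminal (incl.obj unit)
  -- The product of the liftings enters as any `q` with the right projections, so that an instance
  -- may identify `q` with an arrow already known to be cocartesian.
  cocartesian {A A' B B' : 𝒮} (a : A ⟶ A') (b : B ⟶ B') (X : P.Fiber A) (Y : P.Fiber B)
    (q : incl.obj (tens X Y) ⟶ incl.obj (tens (c.obj a X) (c.obj b Y)))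
    (h₁ : q ≫ p₁ _ _ = p₁ X Y ≫ c.lift a X) (h₂ : q ≫ p₂ _ _ = p₂ X Y ≫ c.lift b Y) :
    P.IsStronglyCocartesian (a ⊗ₘ b) q

namespace LiftedProducts

variable {c : Cleavage P} (D : LiftedProducts c)

theorem hom_ext {A B : 𝒮} {X : P.Fiber A} {Y : P.Fiber B} {W : 𝒳}
    {φ ψ : W ⟶ incl.obj (D.tens X Y)} (h₁ : φ ≫ D.p₁ X Y = ψ ≫ D.p₁ X Y)
    (h₂ : φ ≫ D.p₂ X Y = ψ ≫ D.p₂ X Y) : φ = ψ :=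
  Limits.BinaryFan.IsLimit.hom_ext (D.isLimit X Y) h₁ h₂

/-- The product of two arrows. -/
def map {A A' B B' : 𝒮} {X : P.Fiber A} {X' : P.Fiber A'} {Y : P.Fiber B} {Y' : P.Fiber B'}
    (φ : incl.obj X ⟶ incl.obj X') (ψ : incl.obj Y ⟶ incl.obj Y') :
    incl.obj (D.tens X Y) ⟶ incl.obj (D.tens X' Y') :=
  (D.isLimit X' Y').lift (Limits.BinaryFan.mk (D.p₁ X Y ≫ φ) (D.p₂ X Y ≫ ψ))

section

variable {A A' B B' : 𝒮} {X : P.Fiber A} {X' : P.Fiber A'} {Y : P.Fiber B} {Y' : P.Fiber B'}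
    (φ : incl.obj X ⟶ incl.obj X') (ψ : incl.obj Y ⟶ incl.obj Y')

@[simp]
theorem map_p₁ : D.map φ ψ ≫ D.p₁ X' Y' = D.p₁ X Y ≫ φ :=
  (D.isLimit X' Y').fac (Limits.BinaryFan.mk (D.p₁ X Y ≫ φ) (D.p₂ X Y ≫ ψ)) ⟨.left⟩

@[simp]
theorem map_p₂ : D.map φ ψ ≫ D.p₂ X' Y' = D.p₂ X Y ≫ ψ :=
  (D.isLimit X' Y').fac (Limits.BinaryFan.mk (D.p₁ X Y ≫ φ) (D.p₂ X Y ≫ ψ)) ⟨.right⟩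

theorem map_comp {A'' B'' : 𝒮} {X'' : P.Fiber A''} {Y'' : P.Fiber B''}
    (φ' : incl.obj X' ⟶ incl.obj X'') (ψ' : incl.obj Y' ⟶ incl.obj Y'') :
    D.map (φ ≫ φ') (ψ ≫ ψ') = D.map φ ψ ≫ D.map φ' ψ' := by
  apply D.hom_ext
  · rw [map_p₁, Category.assoc, map_p₁, ← Category.assoc (D.map φ ψ), map_p₁, Category.assoc]
  · rw [map_p₂, Category.assoc, map_p₂, ← Category.assoc (D.map φ ψ), map_p₂, Category.assoc]

theorem map_id : D.map (𝟙 (incl.obj X)) (𝟙 (incl.obj Y)) = 𝟙 _ := by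
  apply D.hom_ext <;> simp

instance isIso_map [IsIso φ] [IsIso ψ] : IsIso (D.map φ ψ) :=
  ⟨D.map (inv φ) (inv ψ), by rw [← map_comp]; simp [map_id], by rw [← map_comp]; simp [map_id]⟩

theorem isHomLift_map (f : A ⟶ A') (g : B ⟶ B') [P.IsHomLift f φ] [P.IsHomLift g ψ] :
    P.IsHomLift (f ⊗ₘ g) (D.map φ ψ) := by
  have := D.p₁_over X Y
  have := D.p₂_over X Y
  refine isHomLift_congr (CartesianMonoidalCategory.hom_ext _ _ (by simp) (by simp))
    (isHomLift_lift (D.p₁_over X' Y') (D.p₂_over X' Y') (f := fst _ _ ≫ f) (g := snd _ _ ≫ g)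
      (D.map φ ψ) ?_ ?_)
  · rw [map_p₁]; infer_instance
  · rw [map_p₂]; infer_instance

/-- Any cocartesian arrow is a chosen lifting followed by a vertical isomorphism. Hence the product
of two of them is a product of chosen liftings followed by an isomorphism over `𝟙 A' ⊗ₘ 𝟙 B'`, and
both factors are cocartesian. -/
theorem cocartesian_map (f : A ⟶ A') (g : B ⟶ B') (hφ : P.IsStronglyCocartesian f φ)
    (hψ : P.IsStronglyCocartesian g ψ) : P.IsStronglyCocartesian (f ⊗ₘ g) (D.map φ ψ) := by
  let e := Cleavage.compare f (c.lift f X) φ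
  let e' := Cleavage.compare g (c.lift g Y) ψ
  have h : D.map φ ψ = D.map (c.lift f X) (c.lift g Y) ≫ D.map (incl.map e.hom) (incl.map e'.hom) :=
    by
    rw [← map_comp, Cleavage.compare_hom_fac, Cleavage.compare_hom_fac]
  have h₁ : P.IsStronglyCocartesian (f ⊗ₘ g) (D.map (c.lift f X) (c.lift g Y)) :=
    D.cocartesian f g X Y _ (by simp) (by simp)
  have h₂ : P.IsHomLift (𝟙 A' ⊗ₘ 𝟙 B') (D.map (incl.map e.hom) (incl.map e'.hom)) :=
    D.isHomLift_map _ _ _ _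
  have h₃ : P.IsStronglyCocartesian (𝟙 A' ⊗ₘ 𝟙 B') (D.map (incl.map e.hom) (incl.map e'.hom)) :=
    IsStronglyCocartesian.of_isIso P _ _
  have h₄ : P.IsStronglyCocartesian ((f ⊗ₘ g) ≫ (𝟙 A' ⊗ₘ 𝟙 B'))
    (D.map (c.lift f X) (c.lift g Y) ≫ D.map (incl.map e.hom) (incl.map e'.hom)) := inferInstance
  rw [h]
  convert h₄
  simp

end

/-- The cartesian monoidal structure given by the lifted products. -/
abbrev cartesianMonoidal : CartesianMonoidalCategory 𝒳 :=
  CartesianMonoidalCategory.ofChosenFiniteProducts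
    ⟨Limits.asEmptyCone (incl.obj D.unit), D.isTerminal⟩
    -- Every object of `𝒳` is regarded as an object of the fibre over its own image.
    fun X Y => ⟨_, D.isLimit (Fiber.mk (p := P) (a := X) rfl) (Fiber.mk (p := P) (a := Y) rfl)⟩

theorem exists_isCartesianMonoidalOpfibration (D : LiftedProducts c) :
    ∃ _ : CartesianMonoidalCategory 𝒳, IsCartesianMonoidalOpfibration P := by
  let := D.cartesianMonoidal
  refine ⟨this, .of_projections D.unit.2 (fun _ _ => D.p₁_over _ _) (fun _ _ => D.p₂_over _ _) ?_⟩
  intro A A' B B' X X' Y Y' f g φ ψ hφ hψ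
  -- This replaces `f` by `P.map φ` and its ends by the images of `X` and `X'`, the fibres in which
  -- the chosen products are taken.
  obtain ⟨⟩ := hφ.toIsHomLift
  obtain ⟨⟩ := hψ.toIsHomLift
  exact D.cocartesian_map (X := Fiber.mk (p := P) (a := X) rfl)
    (X' := Fiber.mk (p := P) (a := X') rfl) (Y := Fiber.mk (p := P) (a := Y) rfl)
    (Y' := Fiber.mk (p := P) (a := Y') rfl) φ ψ (P.map φ) (P.map ψ) hφ hψ

end LiftedProducts
end Products

/-! ### Arrows over `f` as vertical arrows out of `f_* X` -/

namespace Cleavage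

section

variable {𝒮 : Type u₁} [Category.{v₁} 𝒮] {𝒳 : Type u₂} [Category.{v₂} 𝒳] {P : 𝒳 ⥤ 𝒮}
  (c : Cleavage P)

/-- The inclusion of the fibres, as the values of the pseudofunctor, in the total category. -/
noncomputable def fib (A : 𝒮) : c.pseudofunctor.obj ⟨A⟩ ⥤ 𝒳 := incl (P := P) (A := A)

/-- The chosen lifting of `f` at `X`, where `f_* X` is a value of the pseudofunctor. -/
noncomputable def lifting {A A' : 𝒮} (f : A ⟶ A') (X : c.pseudofunctor.obj ⟨A⟩) :
    (c.fib A).obj X ⟶ (c.fib A').obj ((fmap c.pseudofunctor f).obj X) :=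
  c.hat f X

/-- The arrow over `f` that corresponds to the vertical arrow `u : f_* X ⟶ Y`. -/
noncomputable def total {A A' : 𝒮} (f : A ⟶ A') {X : c.pseudofunctor.obj ⟨A⟩}
    {Y : c.pseudofunctor.obj ⟨A'⟩}
    (u : (fmap c.pseudofunctor f).obj X ⟶ Y) : (c.fib A).obj X ⟶ (c.fib A').obj Y :=
  c.lifting f X ≫ (c.fib A').map u

variable {c}

theorem fib_map_injective {A : 𝒮} {X Y : c.pseudofunctor.obj ⟨A⟩} {u v : X ⟶ Y}
    (h : (c.fib A).map u = (c.fib A).map v) : u = v :=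
  (incl (P := P) (A := A)).map_injective h

theorem isHomLift_fib_map {A : 𝒮} {X Y : c.pseudofunctor.obj ⟨A⟩} (u : X ⟶ Y) :
    P.IsHomLift (𝟙 A) ((c.fib A).map u) :=
  Subtype.property (p := fun φ => P.IsHomLift (𝟙 A) φ) u

theorem cocartesian_lifting {A A' : 𝒮} (f : A ⟶ A') (X : c.pseudofunctor.obj ⟨A⟩) :
    P.IsStronglyCocartesian f (c.lifting f X) := c.cocartesian f X

/-- A vertical arrow of `𝒳` as an arrow of the value of the pseudofunctor. -/
noncomputable def toFib {A : 𝒮} {X Y : c.pseudofunctor.obj ⟨A⟩}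
    (φ : (c.fib A).obj X ⟶ (c.fib A).obj Y)
    (h : P.IsHomLift (𝟙 A) φ) : X ⟶ Y :=
  vert (P := P) (A := A) φ h

theorem isHomLift_total {A A' : 𝒮} (f : A ⟶ A') {X : c.pseudofunctor.obj ⟨A⟩}
    {Y : c.pseudofunctor.obj ⟨A'⟩} (u : (fmap c.pseudofunctor f).obj X ⟶ Y) :
    P.IsHomLift f (c.total f u) := by
  have := cocartesian_lifting f X
  have := isHomLift_fib_map u
  exact inferInstanceAs (P.IsHomLift f (c.lifting f X ≫ (c.fib A').map u))

theorem ext_of_cocartesian {A A' : 𝒮} {f : A ⟶ A'} {W : 𝒳}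
    {Y Z : c.pseudofunctor.obj ⟨A'⟩} {φ : W ⟶ (c.fib A').obj Y}
    (hφ : P.IsStronglyCocartesian f φ) {u v : Y ⟶ Z}
    (h : φ ≫ (c.fib A').map u = φ ≫ (c.fib A').map v) : u = v := by
  have := isHomLift_fib_map u
  have := isHomLift_fib_map v
  exact fib_map_injective (IsStronglyCocartesian.ext P f φ (𝟙 A') h)

/-- The uniqueness half of the correspondence. Equations between 2-cells are proved by applying it
and computing `total` of both sides in `𝒳`. -/
theorem total_injective {A A' : 𝒮} {f : A ⟶ A'} {X : c.pseudofunctor.obj ⟨A⟩}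
    {Y : c.pseudofunctor.obj ⟨A'⟩} {u v : (fmap c.pseudofunctor f).obj X ⟶ Y}
    (h : c.total f u = c.total f v) : u = v :=
  ext_of_cocartesian (cocartesian_lifting f X) h

@[simp]
theorem total_id {A A' : 𝒮} (f : A ⟶ A') (X : c.pseudofunctor.obj ⟨A⟩) :
    c.total f (𝟙 ((fmap c.pseudofunctor f).obj X)) = c.lifting f X := by
  simp [total]

@[simp]
theorem total_comp {A A' : 𝒮} (f : A ⟶ A') {X : c.pseudofunctor.obj ⟨A⟩}
    {Y Z : c.pseudofunctor.obj ⟨A'⟩} (u : (fmap c.pseudofunctor f).obj X ⟶ Y) (v : Y ⟶ Z) :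
    c.total f (u ≫ v) = c.total f u ≫ (c.fib A').map v := by
  simp [total]

@[simp]
theorem total_map_comp {A A' : 𝒮} (f : A ⟶ A') {X X' : c.pseudofunctor.obj ⟨A⟩}
    {Y : c.pseudofunctor.obj ⟨A'⟩} (u : X ⟶ X') (v : (fmap c.pseudofunctor f).obj X' ⟶ Y) :
    c.total f ((fmap c.pseudofunctor f).map u ≫ v) = (c.fib A).map u ≫ c.total f v := by
  simp only [total, Functor.map_comp]
  exact c.hat_push_map_assoc f u _

theorem lifting_map {A A' : 𝒮} (f : A ⟶ A') {X X' : c.pseudofunctor.obj ⟨A⟩} (u : X ⟶ X') :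
    c.lifting f X ≫ (c.fib A').map ((fmap c.pseudofunctor f).map u) =
      (c.fib A).map u ≫ c.lifting f X' :=
  c.hat_push_map f u

theorem lifting_map_assoc {A A' : 𝒮} (f : A ⟶ A') {X X' : c.pseudofunctor.obj ⟨A⟩} (u : X ⟶ X')
    {T : 𝒳} (t : (c.fib A').obj ((fmap c.pseudofunctor f).obj X') ⟶ T) :
    c.lifting f X ≫ (c.fib A').map ((fmap c.pseudofunctor f).map u) ≫ t =
      (c.fib A).map u ≫ c.lifting f X' ≫ t := by
  simpa only [Category.assoc] using congrArg (· ≫ t) (lifting_map f u)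

-- The coherence cell at an identity is by construction the vertical arrow through which the
-- identity of `X` factors.
@[simp]
theorem total_unitCell {A : 𝒮} (X : c.pseudofunctor.obj ⟨A⟩) :
    c.total (𝟙 A) (unitCell X) = 𝟙 _ :=
  c.hat_pushId A X

theorem lifting_mapId {A : 𝒮} (X : c.pseudofunctor.obj ⟨A⟩) :
    c.lifting (𝟙 A) X ≫ (c.fib A).map ((c.pseudofunctor.mapId ⟨A⟩).hom.toNatTrans.app X) = 𝟙 _ :=
  c.hat_pushId A X

theorem lifting_mapComp {A A' A'' : 𝒮} (f : A ⟶ A') (g : A' ⟶ A'') (X : c.pseudofunctor.obj ⟨A⟩) :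
    c.lifting (f ≫ g) X ≫
      (c.fib A'').map ((c.pseudofunctor.mapComp f.toLoc g.toLoc).hom.toNatTrans.app X) =
      c.lifting f X ≫ c.lifting g ((fmap c.pseudofunctor f).obj X) :=
  c.hat_pushComp f g X

theorem lifting_map₂ {A A' : 𝒮} {f g : A ⟶ A'} (η : f.toLoc ⟶ g.toLoc)
    (X : c.pseudofunctor.obj ⟨A⟩) :
    c.lifting f X ≫ (c.fib A').map ((c.pseudofunctor.map₂ η).toNatTrans.app X) =
      c.lifting g X := by
  obtain rfl : f = g := congrArg Discrete.as (LocallyDiscrete.eq_of_hom η)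
  obtain rfl : η = 𝟙 _ := Subsingleton.elim _ _
  simp

theorem lifting_map₂_assoc {A A' : 𝒮} {f g : A ⟶ A'} (η : f.toLoc ⟶ g.toLoc)
    (X : c.pseudofunctor.obj ⟨A⟩)
    {T : 𝒳} (t : (c.fib A').obj ((fmap c.pseudofunctor g).obj X) ⟶ T) :
    c.lifting f X ≫ (c.fib A').map ((c.pseudofunctor.map₂ η).toNatTrans.app X) ≫ t =
      c.lifting g X ≫ t := by
  simpa only [Category.assoc] using congrArg (· ≫ t) (lifting_map₂ η X)

theorem lifting_mapComp' {A A' A'' : 𝒮} (f : A ⟶ A') (g : A' ⟶ A'') (k : A ⟶ A'')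
    (h : f.toLoc ≫ g.toLoc = k.toLoc) (X : c.pseudofunctor.obj ⟨A⟩) :
    c.lifting k X ≫
      (c.fib A'').map ((c.pseudofunctor.mapComp' f.toLoc g.toLoc k.toLoc h).hom.toNatTrans.app X) =
      c.lifting f X ≫ c.lifting g ((fmap c.pseudofunctor f).obj X) := by
  obtain rfl : f ≫ g = k := congrArg Discrete.as h
  refine Eq.trans ?_ (c.lifting_mapComp f g X)
  rw [show c.pseudofunctor.mapComp' f.toLoc g.toLoc (f ≫ g).toLoc h =
    c.pseudofunctor.mapComp f.toLoc g.toLoc from c.pseudofunctor.mapComp'_eq_mapComp _ _]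

theorem lifting_mapComp'_assoc {A A' A'' : 𝒮} (f : A ⟶ A') (g : A' ⟶ A'') (k : A ⟶ A'')
    (h : f.toLoc ≫ g.toLoc = k.toLoc) (X : c.pseudofunctor.obj ⟨A⟩)
    {T : 𝒳} (t : (c.fib A'').obj ((fmap c.pseudofunctor g).obj ((fmap c.pseudofunctor f).obj X)) ⟶
    T) :
    c.lifting k X ≫
      (c.fib A'').map ((c.pseudofunctor.mapComp' f.toLoc g.toLoc k.toLoc h).hom.toNatTrans.app X) ≫
        t =
      c.lifting f X ≫ c.lifting g ((fmap c.pseudofunctor f).obj X) ≫ t := by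
  simpa only [Category.assoc] using congrArg (· ≫ t) (lifting_mapComp' f g k h X)

-- The coherence cell inside `paste` replaces the lifting of `k` by the composite of the liftings of
-- `f` and `g`; naturality of the lifting of `g` then moves `u` in front of it.
@[simp]
theorem total_paste {A A' A'' : 𝒮} {f : A ⟶ A'} {g : A' ⟶ A''} {k : A ⟶ A''} (h : f ≫ g = k)
    {X : c.pseudofunctor.obj ⟨A⟩} {Y : c.pseudofunctor.obj ⟨A'⟩} {Z : c.pseudofunctor.obj ⟨A''⟩}
    (u : (fmap c.pseudofunctor f).obj X ⟶ Y) (v : (fmap c.pseudofunctor g).obj Y ⟶ Z) :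
    c.total k (paste h u v) = c.total f u ≫ c.total g v := by
  simp only [paste, total, Functor.map_comp]
  rw [lifting_mapComp'_assoc, lifting_map_assoc, Category.assoc]

/-- The isomorphism `f_* X ≅ Y` that corresponds to a cocartesian arrow over `f`. -/
noncomputable def isoOfCocartesian {A A' : 𝒮} (f : A ⟶ A') {X : c.pseudofunctor.obj ⟨A⟩}
    {Y : c.pseudofunctor.obj ⟨A'⟩} (φ : (c.fib A).obj X ⟶ (c.fib A').obj Y)
    (hφ : P.IsStronglyCocartesian f φ) : (fmap c.pseudofunctor f).obj X ≅ Y :=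
  @compare _ _ _ _ P _ _ f X (c.obj f X) Y (c.lift f X) φ (c.cocartesian f X) hφ

@[simp]
theorem total_isoOfCocartesian_hom {A A' : 𝒮} (f : A ⟶ A') {X : c.pseudofunctor.obj ⟨A⟩}
    {Y : c.pseudofunctor.obj ⟨A'⟩} (φ : (c.fib A).obj X ⟶ (c.fib A').obj Y)
    (hφ : P.IsStronglyCocartesian f φ) : c.total f (isoOfCocartesian f φ hφ).hom = φ :=
  @compare_hom_fac _ _ _ _ P _ _ f X (c.obj f X) Y (c.lift f X) φ (c.cocartesian f X) hφ

@[simp]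
theorem comp_isoOfCocartesian_inv {A A' : 𝒮} (f : A ⟶ A') {X : c.pseudofunctor.obj ⟨A⟩}
    {Y : c.pseudofunctor.obj ⟨A'⟩} (φ : (c.fib A).obj X ⟶ (c.fib A').obj Y)
    (hφ : P.IsStronglyCocartesian f φ) :
    φ ≫ (c.fib A').map (isoOfCocartesian f φ hφ).inv = c.lifting f X :=
  @compare_inv_fac _ _ _ _ P _ _ f X (c.obj f X) Y (c.lift f X) φ (c.cocartesian f X) hφ

/-- The vertical arrow `f_* X ⟶ Y` that corresponds to an arrow over `f`. -/
noncomputable def descend {A A' : 𝒮} (f : A ⟶ A') {X : c.pseudofunctor.obj ⟨A⟩}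
    {Y : c.pseudofunctor.obj ⟨A'⟩} (φ : (c.fib A).obj X ⟶ (c.fib A').obj Y)
    (hφ : P.IsHomLift f φ) : (fmap c.pseudofunctor f).obj X ⟶ Y :=
  @desc _ _ _ _ P _ _ f X (c.obj f X) Y (c.lift f X) φ (c.cocartesian f X) hφ

@[simp]
theorem total_descend {A A' : 𝒮} (f : A ⟶ A') {X : c.pseudofunctor.obj ⟨A⟩}
    {Y : c.pseudofunctor.obj ⟨A'⟩} (φ : (c.fib A).obj X ⟶ (c.fib A').obj Y)
    (hφ : P.IsHomLift f φ) : c.total f (descend f φ hφ) = φ :=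
  @fac _ _ _ _ P _ _ f X (c.obj f X) Y (c.lift f X) φ (c.cocartesian f X) hφ

/-- The coherence isomorphism of a square compares the two decompositions of its diagonal. Both
sides are therefore the lifting of `t ≫ r` followed by the coherence cell to `b_* l_*`. -/
theorem lifting_isoMapOfCommSq {A B C D : 𝒮} {t : A ⟶ B} {l : A ⟶ C} {r : B ⟶ D} {b : C ⟶ D}
    (sq : CommSq t.toLoc l.toLoc r.toLoc b.toLoc) (X : c.pseudofunctor.obj ⟨A⟩) :
    c.lifting t X ≫ c.lifting r ((fmap c.pseudofunctor t).obj X) ≫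
      (c.fib D).map ((c.pseudofunctor.isoMapOfCommSq sq).hom.toNatTrans.app X) =
      c.lifting l X ≫ c.lifting b ((fmap c.pseudofunctor l).obj X) := by
  have e : (c.pseudofunctor.mapComp t.toLoc r.toLoc).hom ≫ (c.pseudofunctor.isoMapOfCommSq sq).hom =
      (c.pseudofunctor.mapComp' l.toLoc b.toLoc (t ≫ r).toLoc sq.w.symm).hom := by
    rw [Pseudofunctor.isoMapOfCommSq, Iso.trans_hom, Iso.symm_hom, Iso.hom_inv_id_assoc]
    rfl
  refine (Category.assoc _ _ _).symm.trans (Eq.trans ?_ (lifting_mapComp' l b (t ≫ r) sq.w.symm X))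
  rw [← lifting_mapComp, Category.assoc]
  exact congrArg (c.lifting (t ≫ r) X ≫ ·) (((c.fib D).map_comp _ _).symm.trans
    (congrArg (fun η => (c.fib D).map (η.toNatTrans.app X)) e))

/-- A vertical isomorphism is cocartesian over the identity, and cocartesian arrows compose. -/
theorem cocartesian_total {A A' : 𝒮} (f : A ⟶ A') {X : c.pseudofunctor.obj ⟨A⟩}
    {Y : c.pseudofunctor.obj ⟨A'⟩} (u : (fmap c.pseudofunctor f).obj X ⟶ Y) (hu : IsIso u) :
    P.IsStronglyCocartesian f (c.total f u) := by
  have := cocartesian_lifting f X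
  have := isHomLift_fib_map u
  have : P.IsStronglyCocartesian (𝟙 A') ((c.fib A').map u) :=
    IsStronglyCocartesian.of_isIso P _ _
  have h : P.IsStronglyCocartesian (f ≫ 𝟙 A') (c.total f u) :=
    inferInstanceAs (P.IsStronglyCocartesian (f ≫ 𝟙 A') (c.lifting f X ≫ (c.fib A').map u))
  rwa [Category.comp_id] at h

end
end Cleavage

/-! ### Products from a lax monoidal structure -/

section

variable {𝒮 : Type u₁} [Category.{v₁} 𝒮] [CartesianMonoidalCategory 𝒮]
  {𝒳 : Type u₂} [Category.{v₂} 𝒳] {P : 𝒳 ⥤ 𝒮} {c : Cleavage P}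

/-- Here strong, rather than lax, naturality of `R` enters: invertibility of this cell is what makes
products of cocartesian arrows cocartesian. -/
instance isIso_comparison (F : Pseudofunctor (LocallyDiscrete 𝒮) Cat.{v₂, u₂})
    (R : Pseudofunctor.StrongTrans (prodPseudo F) (tensorPseudo F))
    {A A' B B' : 𝒮} (a : A ⟶ A') (b : B ⟶ B') (X : F.obj ⟨A⟩) (Y : F.obj ⟨B⟩) :
    IsIso (comparison R a b X Y) :=
  ((Cat.Hom.toNatIso (R.naturality (Quiver.Hom.toLoc ((a, b) : (A, B) ⟶ (A', B'))))).app
    (X, Y)).isIso_inv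

/-- The product structure that underlies a lax monoidal structure given by products. -/
noncomputable def TensorIsProduct.liftedProducts
    {R : Pseudofunctor.StrongTrans (prodPseudo c.pseudofunctor) (tensorPseudo c.pseudofunctor)}
    {R1 : Pseudofunctor.StrongTrans unitPseudo (pointPseudo c.pseudofunctor)}
    (hR : TensorIsProduct c R) (hR1 : UnitIsTerminal c R1) : LiftedProducts c where
  tens {A B} X Y := tens R (A := A) (B := B) X Y
  p₁ := hR.p₁
  p₂ := hR.p₂
  p₁_over := hR.p₁_over
  p₂_over := hR.p₂_over
  isLimit X Y := (hR.isProduct X Y).some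
  unit := unitObj R1
  isTerminal := hR1.some
  cocartesian {A A' B B'} a b X Y q h₁ h₂ := by
    -- The two comparison conditions say that this arrow has the projections of the product of the
    -- liftings, as `q` has.
    have : q = c.total (a ⊗ₘ b) (comparison R a b X Y) :=
      Limits.BinaryFan.IsLimit.hom_ext (hR.isProduct (c.obj a X) (c.obj b Y)).some
        (h₁.trans ((Category.assoc _ _ _).trans (hR.comparison_p₁ a b X Y)).symm)
        (h₂.trans ((Category.assoc _ _ _).trans (hR.comparison_p₂ a b X Y)).symm)
    rw [this]
    exact Cleavage.cocartesian_total _ _ (isIso_comparison _ R a b X Y)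

end

/-! ### The product of the fibres as a pseudonatural transformation -/

section

variable {𝒮 : Type u₁} [Category.{v₁} 𝒮] [CartesianMonoidalCategory 𝒮]
  {𝒳 : Type u₂} [Category.{v₂} 𝒳] {P : 𝒳 ⥤ 𝒮} {c : Cleavage P}

open Cleavage

/-- The coherence cell of `tensorPseudo` is that of `F` preceded by the image of the equality `𝟙 ⊗ₘ
𝟙 = 𝟙`; the latter only exchanges one chosen lifting for the other. -/
theorem lifting_tensorPseudo_mapId {A : 𝒮 × 𝒮} (X : c.pseudofunctor.obj ⟨A.1 ⊗ A.2⟩) :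
    c.lifting (𝟙 A.1 ⊗ₘ 𝟙 A.2) X ≫ (c.fib (A.1 ⊗ A.2)).map
      (((tensorPseudo c.pseudofunctor).mapId ⟨A⟩).hom.toNatTrans.app X) = 𝟙 _ := by
  refine Eq.trans ?_ (lifting_mapId X)
  refine Eq.trans (congrArg (c.lifting (𝟙 A.1 ⊗ₘ 𝟙 A.2) X ≫ ·) ((c.fib (A.1 ⊗ A.2)).map_comp
    ((c.pseudofunctor.map₂ ((tensor 𝒮).toPseudofunctor.mapId ⟨A⟩).hom).toNatTrans.app X)
    ((c.pseudofunctor.mapId ⟨A.1 ⊗ A.2⟩).hom.toNatTrans.app X))) ?_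
  exact lifting_map₂_assoc (c := c) (f := 𝟙 A.1 ⊗ₘ 𝟙 A.2) (g := 𝟙 (A.1 ⊗ A.2)) _ X _

theorem lifting_tensorPseudo_mapComp {A A' A'' : 𝒮 × 𝒮} (f : A ⟶ A') (g : A' ⟶ A'')
    (X : c.pseudofunctor.obj ⟨A.1 ⊗ A.2⟩) :
    c.lifting ((f.1 ≫ g.1) ⊗ₘ (f.2 ≫ g.2)) X ≫ (c.fib (A''.1 ⊗ A''.2)).map
      (((tensorPseudo c.pseudofunctor).mapComp f.toLoc g.toLoc).hom.toNatTrans.app X) =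
      c.lifting (f.1 ⊗ₘ f.2) X ≫ c.lifting (g.1 ⊗ₘ g.2) _ := by
  refine Eq.trans ?_ (lifting_mapComp (f.1 ⊗ₘ f.2) (g.1 ⊗ₘ g.2) X)
  refine Eq.trans (congrArg (c.lifting ((f.1 ≫ g.1) ⊗ₘ (f.2 ≫ g.2)) X ≫ ·)
    ((c.fib (A''.1 ⊗ A''.2)).map_comp
    ((c.pseudofunctor.map₂ ((tensor 𝒮).toPseudofunctor.mapComp f.toLoc g.toLoc).hom).toNatTrans.app
      X)
    ((c.pseudofunctor.mapComp (f.1 ⊗ₘ f.2).toLoc (g.1 ⊗ₘ g.2).toLoc).hom.toNatTrans.app X))) ?_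
  exact lifting_map₂_assoc (c := c) (f := (f.1 ≫ g.1) ⊗ₘ (f.2 ≫ g.2))
    (g := (f.1 ⊗ₘ f.2) ≫ (g.1 ⊗ₘ g.2)) _ X _

namespace IsCartesianMonoidalOpfibration

variable [CartesianMonoidalCategory 𝒳]

theorem tensor_over (H : IsCartesianMonoidalOpfibration P) {A B : 𝒮} {X Y : 𝒳} (hX : P.obj X = A)
    (hY : P.obj Y = B) :
    P.obj (X ⊗ Y) = A ⊗ B := by
  subst hX hY; exact H.obj_tensor X Y

theorem isHomLift_tensor (H : IsCartesianMonoidalOpfibration P) {A A' B B' : 𝒮} {X X' Y Y' : 𝒳}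
    {f : A ⟶ A'} {g : B ⟶ B'} {φ : X ⟶ X'}
    {ψ : Y ⟶ Y'} (hφ : P.IsHomLift f φ) (hψ : P.IsHomLift g ψ) :
    P.IsHomLift (f ⊗ₘ g) (φ ⊗ₘ ψ) := by
  obtain ⟨⟩ := hφ; obtain ⟨⟩ := hψ; exact H.map_tensor φ ψ

theorem isHomLift_associator (H : IsCartesianMonoidalOpfibration P) {A B C : 𝒮} {X Y Z : 𝒳}
    (hX : P.obj X = A) (hY : P.obj Y = B)
    (hZ : P.obj Z = C) : P.IsHomLift (α_ A B C).hom (α_ X Y Z).hom := by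
  subst hX hY hZ; exact H.map_associator X Y Z

/-- Strict monoidality speaks of unitors, not of projections. But a projection is `(𝟙 ⊗ₘ toUnit) ≫
ρ`, upstairs and downstairs, and `toUnit` lies over `toUnit` because the unit lies over the terminal
object. -/
theorem isHomLift_fst (H : IsCartesianMonoidalOpfibration P) {A B : 𝒮} {X Y : 𝒳} (hX : P.obj X = A)
    (hY : P.obj Y = B) :
    P.IsHomLift (fst A B) (fst X Y) := by
  subst hX hY
  have h₁ := H.isHomLift_tensor (IsHomLift.id (p := P) (a := X) rfl)
    (isHomLift_toUnit (P := P) rfl H.obj_unit (toUnit Y))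
  have h₂ := H.map_rightUnitor X
  rw [show fst X Y = (𝟙 X ⊗ₘ toUnit Y) ≫ (ρ_ X).hom by simp [rightUnitor_hom],
    show fst (P.obj X) (P.obj Y) = (𝟙 _ ⊗ₘ toUnit _) ≫ (ρ_ _).hom by simp [rightUnitor_hom]]
  infer_instance

theorem isHomLift_snd (H : IsCartesianMonoidalOpfibration P) {A B : 𝒮} {X Y : 𝒳}
    (hX : P.obj X = A) (hY : P.obj Y = B) : P.IsHomLift (snd A B) (snd X Y) := by
  subst hX hY
  have h₁ := H.isHomLift_tensor (isHomLift_toUnit (P := P) rfl H.obj_unit (toUnit X))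
    (IsHomLift.id (p := P) (a := Y) rfl)
  have h₂ := H.map_leftUnitor Y
  rw [show snd X Y = (toUnit X ⊗ₘ 𝟙 Y) ≫ (λ_ Y).hom by simp [leftUnitor_hom],
    show snd (P.obj X) (P.obj Y) = (toUnit _ ⊗ₘ 𝟙 _) ≫ (λ_ _).hom by simp [leftUnitor_hom]]
  infer_instance

theorem isHomLift_pair (H : IsCartesianMonoidalOpfibration P) {A B C : 𝒮} {W X Y : 𝒳}
    (hX : P.obj X = A) (hY : P.obj Y = B) {f : C ⟶ A} {g : C ⟶ B} {φ : W ⟶ X} {ψ : W ⟶ Y}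
    (hφ : P.IsHomLift f φ) (hψ : P.IsHomLift g ψ) : P.IsHomLift (lift f g) (lift φ ψ) :=
  isHomLift_lift (H.isHomLift_fst hX hY) (H.isHomLift_snd hX hY) _
    ((lift_fst φ ψ).symm ▸ hφ) ((lift_snd φ ψ).symm ▸ hψ)

/-- The product of objects of the fibres. -/
noncomputable def tensObj (H : IsCartesianMonoidalOpfibration P) {A B : 𝒮}
    (X : c.pseudofunctor.obj ⟨A⟩)
    (Y : c.pseudofunctor.obj ⟨B⟩) : c.pseudofunctor.obj ⟨A ⊗ B⟩ :=
  Fiber.mk (p := P) (a := (c.fib A).obj X ⊗ (c.fib B).obj Y) (H.tensor_over X.2 Y.2)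

/-- The product of arrows of `𝒳` between objects of the fibres. -/
noncomputable def prodHom (H : IsCartesianMonoidalOpfibration P) {A A' B B' : 𝒮}
    {X : c.pseudofunctor.obj ⟨A⟩} {X' : c.pseudofunctor.obj ⟨A'⟩} {Y : c.pseudofunctor.obj ⟨B⟩}
    {Y' : c.pseudofunctor.obj ⟨B'⟩} (φ : (c.fib A).obj X ⟶ (c.fib A').obj X')
    (ψ : (c.fib B).obj Y ⟶ (c.fib B').obj Y') :
    (c.fib (A ⊗ B)).obj (H.tensObj X Y) ⟶ (c.fib (A' ⊗ B')).obj (H.tensObj X' Y') :=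
  φ ⊗ₘ ψ

theorem prodHom_comp_prodHom (H : IsCartesianMonoidalOpfibration P) {A A' A'' B B' B'' : 𝒮}
    {X : c.pseudofunctor.obj ⟨A⟩} {X' : c.pseudofunctor.obj ⟨A'⟩}
    {X'' : c.pseudofunctor.obj ⟨A''⟩} {Y : c.pseudofunctor.obj ⟨B⟩}
    {Y' : c.pseudofunctor.obj ⟨B'⟩} {Y'' : c.pseudofunctor.obj ⟨B''⟩}
    (φ : (c.fib A).obj X ⟶ (c.fib A').obj X') (ψ : (c.fib B).obj Y ⟶ (c.fib B').obj Y')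
    (φ' : (c.fib A').obj X' ⟶ (c.fib A'').obj X'')
    (ψ' : (c.fib B').obj Y' ⟶ (c.fib B'').obj Y'') :
    H.prodHom φ ψ ≫ H.prodHom φ' ψ' = H.prodHom (φ ≫ φ') (ψ ≫ ψ') :=
  tensorHom_comp_tensorHom _ _ _ _

@[simp]
theorem prodHom_id (H : IsCartesianMonoidalOpfibration P) {A B : 𝒮} (X : c.pseudofunctor.obj ⟨A⟩)
    (Y : c.pseudofunctor.obj ⟨B⟩) :
    H.prodHom (𝟙 ((c.fib A).obj X)) (𝟙 ((c.fib B).obj Y)) = 𝟙 _ :=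
  id_tensorHom_id _ _

/-- The product of vertical arrows. -/
noncomputable def tensMap (H : IsCartesianMonoidalOpfibration P) {A B : 𝒮}
    {X X' : c.pseudofunctor.obj ⟨A⟩} {Y Y' : c.pseudofunctor.obj ⟨B⟩} (u : X ⟶ X') (v : Y ⟶ Y') :
    H.tensObj X Y ⟶ H.tensObj X' Y' :=
  toFib (H.prodHom ((c.fib A).map u) ((c.fib B).map v)) (isHomLift_congr (id_tensorHom_id A B)
    (H.isHomLift_tensor (isHomLift_fib_map u) (isHomLift_fib_map v)))

@[simp]
theorem fib_map_tensMap (H : IsCartesianMonoidalOpfibration P) {A B : 𝒮}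
    {X X' : c.pseudofunctor.obj ⟨A⟩} {Y Y' : c.pseudofunctor.obj ⟨B⟩} (u : X ⟶ X') (v : Y ⟶ Y') :
    (c.fib _).map (H.tensMap u v) = H.prodHom ((c.fib A).map u) ((c.fib B).map v) := rfl

/-- The product as a functor between the fibres. -/
noncomputable def tensFunctor (H : IsCartesianMonoidalOpfibration P) (c : Cleavage P) (A B : 𝒮) :
    c.pseudofunctor.obj ⟨A⟩ × c.pseudofunctor.obj ⟨B⟩ ⥤ c.pseudofunctor.obj ⟨A ⊗ B⟩ where
  obj X := H.tensObj X.1 X.2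
  map u := H.tensMap u.1 u.2
  map_id X := fib_map_injective (by simp)
  map_comp u v := fib_map_injective (by simp [prodHom_comp_prodHom])

theorem cocartesian_prodHom_lifting (H : IsCartesianMonoidalOpfibration P) {A A' B B' : 𝒮}
    (a : A ⟶ A') (b : B ⟶ B') (X : c.pseudofunctor.obj ⟨A⟩) (Y : c.pseudofunctor.obj ⟨B⟩) :
    P.IsStronglyCocartesian (a ⊗ₘ b) (H.prodHom (c.lifting a X) (c.lifting b Y)) :=
  H.tensor_cocartesian _ _ _ _ (cocartesian_lifting a X) (cocartesian_lifting b Y)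

/-- The comparison `(a × b)_* (X × Y) ≅ a_* X × b_* Y`. -/
noncomputable def comparisonIso (H : IsCartesianMonoidalOpfibration P) {A A' B B' : 𝒮}
    (a : A ⟶ A') (b : B ⟶ B') (X : c.pseudofunctor.obj ⟨A⟩) (Y : c.pseudofunctor.obj ⟨B⟩) :
    (fmap c.pseudofunctor (a ⊗ₘ b)).obj (H.tensObj X Y) ≅
      H.tensObj ((fmap c.pseudofunctor a).obj X) ((fmap c.pseudofunctor b).obj Y) :=
  isoOfCocartesian (a ⊗ₘ b) (H.prodHom (c.lifting a X) (c.lifting b Y))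
    (H.cocartesian_prodHom_lifting a b X Y)

@[simp]
theorem total_comparisonIso (H : IsCartesianMonoidalOpfibration P) {A A' B B' : 𝒮}
    (a : A ⟶ A') (b : B ⟶ B') (X : c.pseudofunctor.obj ⟨A⟩) (Y : c.pseudofunctor.obj ⟨B⟩) :
    c.total (a ⊗ₘ b) (H.comparisonIso a b X Y).hom = H.prodHom (c.lifting a X) (c.lifting b Y) :=
  total_isoOfCocartesian_hom ..

@[simp]
theorem prodHom_comparisonIso_inv (H : IsCartesianMonoidalOpfibration P) {A A' B B' : 𝒮}
    (a : A ⟶ A') (b : B ⟶ B') (X : c.pseudofunctor.obj ⟨A⟩) (Y : c.pseudofunctor.obj ⟨B⟩) :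
    H.prodHom (c.lifting a X) (c.lifting b Y) ≫ (c.fib _).map (H.comparisonIso a b X Y).inv =
      c.lifting (a ⊗ₘ b) (H.tensObj X Y) :=
  comp_isoOfCocartesian_inv ..

theorem prodHom_comparisonIso_inv_assoc (H : IsCartesianMonoidalOpfibration P) {A A' B B' : 𝒮}
    (a : A ⟶ A') (b : B ⟶ B') (X : c.pseudofunctor.obj ⟨A⟩) (Y : c.pseudofunctor.obj ⟨B⟩)
    {T : 𝒳} (t : (c.fib _).obj ((fmap c.pseudofunctor (a ⊗ₘ b)).obj (H.tensObj X Y)) ⟶ T) :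
    H.prodHom (c.lifting a X) (c.lifting b Y) ≫
      (c.fib _).map (H.comparisonIso a b X Y).inv ≫ t =
      c.lifting (a ⊗ₘ b) (H.tensObj X Y) ≫ t := by
  simpa only [Category.assoc] using congrArg (· ≫ t) (H.prodHom_comparisonIso_inv a b X Y)

theorem comparisonIso_naturality (H : IsCartesianMonoidalOpfibration P) {A A' B B' : 𝒮}
    (a : A ⟶ A') (b : B ⟶ B') {X X' : c.pseudofunctor.obj ⟨A⟩} {Y Y' : c.pseudofunctor.obj ⟨B⟩}
    (u : X ⟶ X') (v : Y ⟶ Y') :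
    (fmap c.pseudofunctor (a ⊗ₘ b)).map (H.tensMap u v) ≫ (H.comparisonIso a b X' Y').hom =
      (H.comparisonIso a b X Y).hom ≫
        H.tensMap ((fmap c.pseudofunctor a).map u) ((fmap c.pseudofunctor b).map v) := by
  apply total_injective
  rw [total_map_comp, total_comp, total_comparisonIso, total_comparisonIso, fib_map_tensMap,
    fib_map_tensMap, prodHom_comp_prodHom, prodHom_comp_prodHom, lifting_map, lifting_map]

/-- Both sides, precomposed with the product of the liftings of the identities, become the identity
of `X × Y`. -/
theorem comparisonIso_id (H : IsCartesianMonoidalOpfibration P) {A : 𝒮 × 𝒮}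
    (X : c.pseudofunctor.obj ⟨A.1⟩) (Y : c.pseudofunctor.obj ⟨A.2⟩) :
    (H.comparisonIso (𝟙 A.1) (𝟙 A.2) X Y).inv ≫
      ((tensorPseudo c.pseudofunctor).mapId ⟨A⟩).hom.toNatTrans.app (H.tensObj X Y) =
    H.tensMap (unitCell X) (unitCell Y) := by
  apply ext_of_cocartesian (H.cocartesian_prodHom_lifting (𝟙 A.1) (𝟙 A.2) X Y)
  rw [fib_map_tensMap, prodHom_comp_prodHom]
  refine Eq.trans (congrArg (_ ≫ ·) ((c.fib _).map_comp _ _)) ?_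
  rw [prodHom_comparisonIso_inv_assoc]
  refine (lifting_tensorPseudo_mapId _).trans ?_
  exact (H.prodHom_id X Y).symm.trans
    (congrArg₂ H.prodHom (total_unitCell X).symm (total_unitCell Y).symm)

theorem prodHom_comparisonIso_inv_comp (H : IsCartesianMonoidalOpfibration P)
    {A A' A'' B B' B'' : 𝒮} (a : A ⟶ A') (b : B ⟶ B') (a' : A' ⟶ A'') (b' : B' ⟶ B'')
    (X : c.pseudofunctor.obj ⟨A⟩) (Y : c.pseudofunctor.obj ⟨B⟩) :
    H.prodHom (c.lifting a X ≫ c.lifting a' _) (c.lifting b Y ≫ c.lifting b' _) ≫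
      (c.fib _).map ((H.comparisonIso a' b' ((fmap c.pseudofunctor a).obj X)
          ((fmap c.pseudofunctor b).obj Y)).inv ≫
        (fmap c.pseudofunctor (a' ⊗ₘ b')).map (H.comparisonIso a b X Y).inv) =
      c.lifting (a ⊗ₘ b) (H.tensObj X Y) ≫ c.lifting (a' ⊗ₘ b') _ := by
  rw [← prodHom_comp_prodHom, Functor.map_comp, Category.assoc, prodHom_comparisonIso_inv_assoc,
    lifting_map, prodHom_comparisonIso_inv_assoc]

/-- Precomposed with the product of the liftings of the composites, both sides become the lifting of
`f.1 ⊗ₘ f.2` followed by that of `g.1 ⊗ₘ g.2`. -/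
theorem comparisonIso_comp (H : IsCartesianMonoidalOpfibration P) {A A' A'' : 𝒮 × 𝒮} (f : A ⟶ A')
    (g : A' ⟶ A'') (X : c.pseudofunctor.obj ⟨A.1⟩) (Y : c.pseudofunctor.obj ⟨A.2⟩) :
    (H.comparisonIso (f.1 ≫ g.1) (f.2 ≫ g.2) X Y).inv ≫
      ((tensorPseudo c.pseudofunctor).mapComp f.toLoc g.toLoc).hom.toNatTrans.app (H.tensObj X Y) =
    H.tensMap ((c.pseudofunctor.mapComp f.1.toLoc g.1.toLoc).hom.toNatTrans.app X)
        ((c.pseudofunctor.mapComp f.2.toLoc g.2.toLoc).hom.toNatTrans.app Y) ≫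
      (H.comparisonIso g.1 g.2 ((fmap c.pseudofunctor f.1).obj X)
        ((fmap c.pseudofunctor f.2).obj Y)).inv ≫
      (fmap c.pseudofunctor (g.1 ⊗ₘ g.2)).map (H.comparisonIso f.1 f.2 X Y).inv := by
  apply ext_of_cocartesian (H.cocartesian_prodHom_lifting (f.1 ≫ g.1) (f.2 ≫ g.2) X Y)
  refine Eq.trans (congrArg (_ ≫ ·) ((c.fib _).map_comp _ _)) ?_
  rw [prodHom_comparisonIso_inv_assoc]
  refine (lifting_tensorPseudo_mapComp f g _).trans ?_
  refine Eq.trans ?_ (congrArg (_ ≫ ·) ((c.fib _).map_comp _ _)).symm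
  refine Eq.trans ?_ (Category.assoc _ _ _)
  exact (H.prodHom_comparisonIso_inv_comp f.1 f.2 g.1 g.2 X Y).symm.trans
    (congrArg (· ≫ _) ((H.prodHom_comp_prodHom _ _ _ _).trans
    (congrArg₂ H.prodHom (lifting_mapComp f.1 g.1 X) (lifting_mapComp f.2 g.2 Y)))).symm

/-- The pseudonaturality of the product of the fibres. -/
noncomputable def tensNaturality (H : IsCartesianMonoidalOpfibration P) (c : Cleavage P)
    {A A' : 𝒮 × 𝒮} (f : A ⟶ A') :
    (fmap c.pseudofunctor f.1).prod (fmap c.pseudofunctor f.2) ⋙ H.tensFunctor c A'.1 A'.2 ≅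
      H.tensFunctor c A.1 A.2 ⋙ fmap c.pseudofunctor (f.1 ⊗ₘ f.2) :=
  -- The comparison starts at `(a × b)_* (X × Y)`, whereas the naturality cell of a strong
  -- transformation ends there.
  Iso.symm (NatIso.ofComponents (fun X => H.comparisonIso f.1 f.2 X.1 X.2)
    fun u => H.comparisonIso_naturality f.1 f.2 u.1 u.2)

/-- The pseudonatural transformation given by the products. -/
noncomputable def strongTrans (H : IsCartesianMonoidalOpfibration P) (c : Cleavage P) :
    Pseudofunctor.StrongTrans (prodPseudo c.pseudofunctor) (tensorPseudo c.pseudofunctor) where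
  app A := (H.tensFunctor c A.as.1 A.as.2).toCatHom
  naturality f := Cat.Hom.isoMk (H.tensNaturality c f.as)
  naturality_naturality η := naturality_of_locallyDiscrete (prodPseudo c.pseudofunctor)
    (tensorPseudo c.pseudofunctor) η (fun A => (H.tensFunctor c A.as.1 A.as.2).toCatHom)
    (fun f => Cat.Hom.isoMk (H.tensNaturality c f.as))
  naturality_id A := by
    ext X
    refine (H.comparisonIso_id X.1 X.2).trans ?_
    exact (Category.comp_id _).symm.trans (congrArg (_ ≫ ·) (Category.comp_id _).symm)
  naturality_comp {A A' A''} f g := by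
    ext X
    refine (H.comparisonIso_comp f.as g.as X.1 X.2).trans ?_
    refine congrArg (_ ≫ ·) ?_
    exact (congrArg (_ ≫ ·) ((Category.comp_id _).symm.trans (Category.id_comp _).symm)).trans
      (Category.id_comp _).symm

end IsCartesianMonoidalOpfibration

end

/-! ### Natural isomorphisms from cocartesian arrows -/

section

variable {𝒮 : Type u₁} [Category.{v₁} 𝒮] {𝒳 : Type u₂} [Category.{v₂} 𝒳] {P : 𝒳 ⥤ 𝒮}
  {c : Cleavage P}

open Cleavage

theorem Cleavage.total_paste_of {A A' A'' : 𝒮} {f : A ⟶ A'} {g : A' ⟶ A''} {k : A ⟶ A''}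
    {h : f ≫ g = k} {X : c.pseudofunctor.obj ⟨A⟩} {Y : c.pseudofunctor.obj ⟨A'⟩}
    {Z : c.pseudofunctor.obj ⟨A''⟩} {u : (fmap c.pseudofunctor f).obj X ⟶ Y}
    {v : (fmap c.pseudofunctor g).obj Y ⟶ Z} {φ : (c.fib A).obj X ⟶ (c.fib A').obj Y}
    {ψ : (c.fib A').obj Y ⟶ (c.fib A'').obj Z} (hu : c.total f u = φ) (hv : c.total g v = ψ) :
    c.total k (paste h u v) = φ ≫ ψ := by
  rw [total_paste, hu, hv]

/-- A natural isomorphism `K ⋙ f_* ≅ G` given by cocartesian arrows over `f`. -/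
noncomputable def Cleavage.natIsoOfCocartesian {E : Type*} [Category* E] {A A' : 𝒮} (f : A ⟶ A')
    (K : E ⥤ c.pseudofunctor.obj ⟨A⟩) (G : E ⥤ c.pseudofunctor.obj ⟨A'⟩)
    (φ : ∀ X, (c.fib A).obj (K.obj X) ⟶ (c.fib A').obj (G.obj X))
    (hφ : ∀ X, P.IsStronglyCocartesian f (φ X))
    (h : ∀ {X Y} (u : X ⟶ Y), (c.fib A).map (K.map u) ≫ φ Y = φ X ≫ (c.fib A').map (G.map u)) :
    K ⋙ fmap c.pseudofunctor f ≅ G :=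
  NatIso.ofComponents (fun X => isoOfCocartesian f (φ X) (hφ X)) fun {X Y} u =>
    total_injective <| (total_map_comp f (K.map u) _).trans <| by
      rw [total_isoOfCocartesian_hom, h]
      refine Eq.trans ?_ (total_comp f (isoOfCocartesian f (φ X) (hφ X)).hom (G.map u)).symm
      rw [total_isoOfCocartesian_hom]

end

/-! ### The lax symmetric monoidal structure given by products -/

section

variable {𝒮 : Type u₁} [Category.{v₁} 𝒮] [CartesianMonoidalCategory 𝒮]
  {𝒳 : Type u₂} [Category.{v₂} 𝒳] {P : 𝒳 ⥤ 𝒮} {c : Cleavage P}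

open Cleavage

namespace IsCartesianMonoidalOpfibration

variable [CartesianMonoidalCategory 𝒳]

/-- The terminal object of `𝒳`, as an object of the fibre. -/
noncomputable def unitFib (H : IsCartesianMonoidalOpfibration P) (c : Cleavage P) :
    c.pseudofunctor.obj ⟨𝟙_ 𝒮⟩ :=
  Fiber.mk (p := P) (a := 𝟙_ 𝒳) H.obj_unit

/-- The unit is terminal in `𝒳`, so the coherence of the unit transformation is automatic. The
isomorphism `e` covers targets that are pushed forward along identities, such as `1_* I`. -/
theorem unitFib_hom_ext (H : IsCartesianMonoidalOpfibration P) {X Y : c.pseudofunctor.obj ⟨𝟙_ 𝒮⟩}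
    (e : Y ≅ H.unitFib c) (u v : X ⟶ Y) : u = v := by
  rw [← cancel_mono e.hom]
  exact fib_map_injective (toUnit_unique (X := (c.fib (𝟙_ 𝒮)).obj X) _ _)

/-- The isomorphism `1_* X ≅ X`, at an object `X` of the fibre. -/
noncomputable def mapIdIso {A : 𝒮} (X : c.pseudofunctor.obj ⟨A⟩) :
    (fmap c.pseudofunctor (𝟙 A)).obj X ≅ X :=
  (Cat.Hom.toNatIso (c.pseudofunctor.mapId ⟨A⟩)).app X

/-- The pseudonatural transformation given by the terminal object. -/
noncomputable def unitTrans (H : IsCartesianMonoidalOpfibration P) (c : Cleavage P) :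
    Pseudofunctor.StrongTrans unitPseudo (pointPseudo c.pseudofunctor) where
  app _ := ((Functor.const Cat.chosenTerminal.{v₂, u₂}).obj (H.unitFib c)).toCatHom
  naturality f := Cat.Hom.isoMk
    (F := (unitPseudo.map f).toFunctor ⋙ (Functor.const _).obj (H.unitFib c))
    (G := (Functor.const _).obj (H.unitFib c) ⋙ fmap c.pseudofunctor (𝟙 (𝟙_ 𝒮)))
    (NatIso.ofComponents (fun _ => (mapIdIso (H.unitFib c)).symm)
      fun _ => H.unitFib_hom_ext (mapIdIso (H.unitFib c)) _ _)
  naturality_naturality η := by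
    ext X
    exact H.unitFib_hom_ext (mapIdIso (H.unitFib c)) _ _
  naturality_id _ := by
    ext X
    exact H.unitFib_hom_ext (Iso.refl (H.unitFib c)) _ _
  naturality_comp f g := by
    ext X
    exact H.unitFib_hom_ext (mapIdIso _ ≪≫ mapIdIso _) _ _

section

variable (H : IsCartesianMonoidalOpfibration P) {A B C : 𝒮}

/-- The comparison is the vertical part of the product of the liftings, so following it by `u × v`
gives the product of the two composites. Together with `total_paste_of` this evaluates every side of
the axioms. -/
theorem total_tensorCell_of {A A' B B' : 𝒮} {a : A ⟶ A'} {b : B ⟶ B'}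
    {X : c.pseudofunctor.obj ⟨A⟩} {X' : c.pseudofunctor.obj ⟨A'⟩} {Y : c.pseudofunctor.obj ⟨B⟩}
    {Y' : c.pseudofunctor.obj ⟨B'⟩} {u : (fmap c.pseudofunctor a).obj X ⟶ X'}
    {v : (fmap c.pseudofunctor b).obj Y ⟶ Y'} {φ : (c.fib A).obj X ⟶ (c.fib A').obj X'}
    {ψ : (c.fib B).obj Y ⟶ (c.fib B').obj Y'} (hu : c.total a u = φ) (hv : c.total b v = ψ) :
    c.total (X := H.tensObj X Y) (Y := H.tensObj X' Y') (a ⊗ₘ b)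
      (tensorCell (H.strongTrans c) a b u v) = H.prodHom φ ψ := by
  subst hu hv
  refine (total_comp (a ⊗ₘ b) (H.comparisonIso a b X Y).hom (H.tensMap u v)).trans ?_
  rw [total_comparisonIso, fib_map_tensMap, prodHom_comp_prodHom]
  rfl

/-- The associator of `𝒳` at objects of the fibres. -/
noncomputable def assocHom (X : c.pseudofunctor.obj ⟨A⟩) (Y : c.pseudofunctor.obj ⟨B⟩)
    (Z : c.pseudofunctor.obj ⟨C⟩) :
    (c.fib _).obj (H.tensObj (H.tensObj X Y) Z) ⟶ (c.fib _).obj (H.tensObj X (H.tensObj Y Z)) :=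
  (α_ ((c.fib A).obj X) ((c.fib B).obj Y) ((c.fib C).obj Z)).hom

/-- The right unitor of `𝒳` at an object of a fibre. -/
noncomputable def rightUnitHom (X : c.pseudofunctor.obj ⟨A⟩) :
    (c.fib _).obj (H.tensObj X (H.unitFib c)) ⟶ (c.fib _).obj X :=
  fst ((c.fib A).obj X) (𝟙_ 𝒳)

/-- The left unitor of `𝒳` at an object of a fibre. -/
noncomputable def leftUnitHom (X : c.pseudofunctor.obj ⟨A⟩) :
    (c.fib _).obj (H.tensObj (H.unitFib c) X) ⟶ (c.fib _).obj X :=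
  snd (𝟙_ 𝒳) ((c.fib A).obj X)

/-- The symmetry of `𝒳` at objects of the fibres. -/
noncomputable def swapHom (X : c.pseudofunctor.obj ⟨A⟩) (Y : c.pseudofunctor.obj ⟨B⟩) :
    (c.fib _).obj (H.tensObj X Y) ⟶ (c.fib _).obj (H.tensObj Y X) :=
  swap ((c.fib A).obj X) ((c.fib B).obj Y)

/-- An isomorphism is cocartesian over whatever it lies over. This applies to all four structure
maps and makes the modifications invertible. -/
theorem cocartesian_assocHom (X : c.pseudofunctor.obj ⟨A⟩) (Y : c.pseudofunctor.obj ⟨B⟩)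
    (Z : c.pseudofunctor.obj ⟨C⟩) :
    P.IsStronglyCocartesian (α_ A B C).hom (H.assocHom X Y Z) := by
  have : P.IsHomLift (α_ A B C).hom (H.assocHom X Y Z) := H.isHomLift_associator X.2 Y.2 Z.2
  have : IsIso (H.assocHom X Y Z) :=
    (α_ ((c.fib A).obj X) ((c.fib B).obj Y) ((c.fib C).obj Z)).isIso_hom
  exact IsStronglyCocartesian.of_isIso P _ _

theorem cocartesian_rightUnitHom (X : c.pseudofunctor.obj ⟨A⟩) :
    P.IsStronglyCocartesian (fst A (𝟙_ 𝒮)) (H.rightUnitHom X) := by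
  have : P.IsHomLift (fst A (𝟙_ 𝒮)) (H.rightUnitHom X) := H.isHomLift_fst X.2 H.obj_unit
  have h : IsIso (fst ((c.fib A).obj X) (𝟙_ 𝒳)) := by rw [← rightUnitor_hom]; infer_instance
  have : IsIso (H.rightUnitHom X) := h
  exact IsStronglyCocartesian.of_isIso P _ _

theorem cocartesian_leftUnitHom (X : c.pseudofunctor.obj ⟨A⟩) :
    P.IsStronglyCocartesian (snd (𝟙_ 𝒮) A) (H.leftUnitHom X) := by
  have : P.IsHomLift (snd (𝟙_ 𝒮) A) (H.leftUnitHom X) := H.isHomLift_snd H.obj_unit X.2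
  have h : IsIso (snd (𝟙_ 𝒳) ((c.fib A).obj X)) := by rw [← leftUnitor_hom]; infer_instance
  have : IsIso (H.leftUnitHom X) := h
  exact IsStronglyCocartesian.of_isIso P _ _

theorem swap_swap {𝒞 : Type*} [Category* 𝒞] [CartesianMonoidalCategory 𝒞] (X Y : 𝒞) :
    swap X Y ≫ swap Y X = 𝟙 _ := by
  ext <;> simp [swap]

theorem isIso_swap {𝒞 : Type*} [Category* 𝒞] [CartesianMonoidalCategory 𝒞] (X Y : 𝒞) :
    IsIso (swap X Y) :=
  ⟨swap Y X, swap_swap X Y, swap_swap Y X⟩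

theorem cocartesian_swapHom (X : c.pseudofunctor.obj ⟨A⟩) (Y : c.pseudofunctor.obj ⟨B⟩) :
    P.IsStronglyCocartesian (swap A B) (H.swapHom X Y) := by
  have : P.IsHomLift (swap A B) (H.swapHom X Y) :=
    H.isHomLift_pair Y.2 X.2 (H.isHomLift_snd X.2 Y.2) (H.isHomLift_fst X.2 Y.2)
  have : IsIso (H.swapHom X Y) := isIso_swap ((c.fib A).obj X) ((c.fib B).obj Y)
  exact IsStronglyCocartesian.of_isIso P _ _

theorem assocHom_naturality {A' B' C' : 𝒮} {X : c.pseudofunctor.obj ⟨A⟩}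
    {Y : c.pseudofunctor.obj ⟨B⟩} {Z : c.pseudofunctor.obj ⟨C⟩} {X' : c.pseudofunctor.obj ⟨A'⟩}
    {Y' : c.pseudofunctor.obj ⟨B'⟩} {Z' : c.pseudofunctor.obj ⟨C'⟩}
    (φ : (c.fib A).obj X ⟶ (c.fib A').obj X') (χ : (c.fib B).obj Y ⟶ (c.fib B').obj Y')
    (ψ : (c.fib C).obj Z ⟶ (c.fib C').obj Z') :
    H.prodHom (H.prodHom φ χ) ψ ≫ H.assocHom X' Y' Z' =
      H.assocHom X Y Z ≫ H.prodHom φ (H.prodHom χ ψ) :=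
  associator_naturality φ χ ψ

theorem rightUnitHom_naturality {A' : 𝒮} {X : c.pseudofunctor.obj ⟨A⟩}
    {X' : c.pseudofunctor.obj ⟨A'⟩} (φ : (c.fib A).obj X ⟶ (c.fib A').obj X')
    (ψ : (c.fib _).obj (H.unitFib c) ⟶ (c.fib _).obj (H.unitFib c)) :
    H.prodHom φ ψ ≫ H.rightUnitHom X' = H.rightUnitHom X ≫ φ :=
  tensorHom_fst φ ψ

theorem leftUnitHom_naturality {A' : 𝒮} {X : c.pseudofunctor.obj ⟨A⟩}
    {X' : c.pseudofunctor.obj ⟨A'⟩} (φ : (c.fib A).obj X ⟶ (c.fib A').obj X')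
    (ψ : (c.fib _).obj (H.unitFib c) ⟶ (c.fib _).obj (H.unitFib c)) :
    H.prodHom ψ φ ≫ H.leftUnitHom X' = H.leftUnitHom X ≫ φ :=
  tensorHom_snd ψ φ

theorem swapHom_naturality {A' B' : 𝒮} {X : c.pseudofunctor.obj ⟨A⟩}
    {Y : c.pseudofunctor.obj ⟨B⟩} {X' : c.pseudofunctor.obj ⟨A'⟩}
    {Y' : c.pseudofunctor.obj ⟨B'⟩} (φ : (c.fib A).obj X ⟶ (c.fib A').obj X')
    (ψ : (c.fib B).obj Y ⟶ (c.fib B').obj Y') :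
    H.prodHom φ ψ ≫ H.swapHom X' Y' = H.swapHom X Y ≫ H.prodHom ψ φ :=
  show (φ ⊗ₘ ψ) ≫ swap ((c.fib A').obj X') ((c.fib B').obj Y') =
      swap ((c.fib A).obj X) ((c.fib B).obj Y) ≫ (ψ ⊗ₘ φ) by
    ext <;> simp [swap]

theorem braid_hexagon {𝒞 : Type*} [Category* 𝒞] [CartesianMonoidalCategory 𝒞] (X Y Z : 𝒞) :
    (α_ X Y Z).hom ≫ swap X (Y ⊗ Z) ≫ (α_ Y Z X).hom =
      (swap X Y ⊗ₘ 𝟙 Z) ≫ (α_ Y X Z).hom ≫ (𝟙 Y ⊗ₘ swap X Z) := by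
  ext <;> simp [swap]

theorem isTerminal_unitTrans : UnitIsTerminal c (H.unitTrans c) := ⟨isTerminalTensorUnit⟩

/-- The product structure of `𝒳` gives the pseudonatural transformation `R`. -/
noncomputable def tensorIsProduct : TensorIsProduct c (H.strongTrans c) where
  p₁ X Y := fst (incl.obj X) (incl.obj Y)
  p₂ X Y := snd (incl.obj X) (incl.obj Y)
  p₁_over X Y := H.isHomLift_fst X.2 Y.2
  p₂_over X Y := H.isHomLift_snd X.2 Y.2
  isProduct X Y := ⟨tensorProductIsBinaryProduct (incl.obj X) (incl.obj Y)⟩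
  map_p₁ u v := tensorHom_fst (incl.map u) (incl.map v)
  map_p₂ u v := tensorHom_snd (incl.map u) (incl.map v)
  comparison_p₁ a b X Y := (Category.assoc _ _ _).symm.trans
    ((congrArg (· ≫ _) (H.total_comparisonIso a b X Y)).trans
      (tensorHom_fst (c.lift a X) (c.lift b Y)))
  comparison_p₂ a b X Y := (Category.assoc _ _ _).symm.trans
    ((congrArg (· ≫ _) (H.total_comparisonIso a b X Y)).trans
      (tensorHom_snd (c.lift a X) (c.lift b Y)))

theorem assocHom_pentagon {D : 𝒮} (W : c.pseudofunctor.obj ⟨A⟩) (X : c.pseudofunctor.obj ⟨B⟩)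
    (Y : c.pseudofunctor.obj ⟨C⟩) (Z : c.pseudofunctor.obj ⟨D⟩) :
    H.prodHom (H.assocHom W X Y) (𝟙 ((c.fib D).obj Z)) ≫ H.assocHom W (H.tensObj X Y) Z ≫
        H.prodHom (𝟙 ((c.fib A).obj W)) (H.assocHom X Y Z) =
      H.assocHom (H.tensObj W X) Y Z ≫ H.assocHom W X (H.tensObj Y Z) := by
  have h (W X Y Z : 𝒳) : ((α_ W X Y).hom ⊗ₘ 𝟙 Z) ≫ (α_ W (X ⊗ Y) Z).hom ≫
      (𝟙 W ⊗ₘ (α_ X Y Z).hom) = (α_ (W ⊗ X) Y Z).hom ≫ (α_ W X (Y ⊗ Z)).hom := by simp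
  exact h ..

theorem assocHom_triangle (X : c.pseudofunctor.obj ⟨A⟩) (Y : c.pseudofunctor.obj ⟨B⟩) :
    H.prodHom (H.rightUnitHom X) (𝟙 ((c.fib B).obj Y)) =
      H.assocHom X (H.unitFib c) Y ≫ H.prodHom (𝟙 ((c.fib A).obj X)) (H.leftUnitHom Y) := by
  have h (X Y : 𝒳) : (fst X (𝟙_ 𝒳) ⊗ₘ 𝟙 Y) = (α_ X (𝟙_ 𝒳) Y).hom ≫ (𝟙 X ⊗ₘ snd (𝟙_ 𝒳) Y) := by
    ext <;> simp
  exact h ..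

/-- The associativity modification. -/
noncomputable def assocMod (c : Cleavage P) (A B C : 𝒮) :
    ((H.tensFunctor c A B).prod (𝟭 (c.pseudofunctor.obj ⟨C⟩)) ⋙ H.tensFunctor c (A ⊗ B) C) ⋙
        fmap c.pseudofunctor (α_ A B C).hom ≅
      prod.associator (c.pseudofunctor.obj ⟨A⟩) (c.pseudofunctor.obj ⟨B⟩)
          (c.pseudofunctor.obj ⟨C⟩) ⋙
        (𝟭 (c.pseudofunctor.obj ⟨A⟩)).prod (H.tensFunctor c B C) ⋙ H.tensFunctor c A (B ⊗ C) :=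
  natIsoOfCocartesian (α_ A B C).hom _ _ (fun X => H.assocHom X.1.1 X.1.2 X.2)
    (fun X => H.cocartesian_assocHom X.1.1 X.1.2 X.2)
    fun u => H.assocHom_naturality ((c.fib A).map u.1.1) ((c.fib B).map u.1.2)
      ((c.fib C).map u.2)

/-- The right unit modification. -/
noncomputable def rightUnitMod (c : Cleavage P) (A : 𝒮) :
    ((𝟭 (c.pseudofunctor.obj ⟨A⟩)).prod (unitFunctor (H.unitTrans c)) ⋙
      H.tensFunctor c A (𝟙_ 𝒮)) ⋙ fmap c.pseudofunctor (fst A (𝟙_ 𝒮)) ≅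
      CategoryTheory.Prod.fst (c.pseudofunctor.obj ⟨A⟩) Cat.chosenTerminal.{v₂, u₂} :=
  natIsoOfCocartesian (fst A (𝟙_ 𝒮)) _ _ (fun X => H.rightUnitHom X.1)
    (fun X => H.cocartesian_rightUnitHom X.1)
    -- The constant functor sends every arrow of the terminal category to this identity.
    fun u => H.rightUnitHom_naturality ((c.fib A).map u.1) ((c.fib _).map (𝟙 (H.unitFib c)))

/-- The left unit modification. -/
noncomputable def leftUnitMod (c : Cleavage P) (A : 𝒮) :
    ((unitFunctor (H.unitTrans c)).prod (𝟭 (c.pseudofunctor.obj ⟨A⟩)) ⋙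
      H.tensFunctor c (𝟙_ 𝒮) A) ⋙ fmap c.pseudofunctor (snd (𝟙_ 𝒮) A) ≅
      CategoryTheory.Prod.snd Cat.chosenTerminal.{v₂, u₂} (c.pseudofunctor.obj ⟨A⟩) :=
  natIsoOfCocartesian (snd (𝟙_ 𝒮) A) _ _ (fun X => H.leftUnitHom X.2)
    (fun X => H.cocartesian_leftUnitHom X.2)
    fun u => H.leftUnitHom_naturality ((c.fib A).map u.2) ((c.fib _).map (𝟙 (H.unitFib c)))

/-- The symmetry modification. -/
noncomputable def swapMod (c : Cleavage P) (A B : 𝒮) :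
    H.tensFunctor c A B ⋙ fmap c.pseudofunctor (swap A B) ≅
      CategoryTheory.Prod.swap (c.pseudofunctor.obj ⟨A⟩) (c.pseudofunctor.obj ⟨B⟩) ⋙
        H.tensFunctor c B A :=
  natIsoOfCocartesian (swap A B) _ _ (fun X => H.swapHom X.1 X.2)
    (fun X => H.cocartesian_swapHom X.1 X.2)
    fun u => H.swapHom_naturality ((c.fib A).map u.1) ((c.fib B).map u.2)

theorem total_assocMod (X : c.pseudofunctor.obj ⟨A⟩) (Y : c.pseudofunctor.obj ⟨B⟩)
    (Z : c.pseudofunctor.obj ⟨C⟩) :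
    c.total (X := H.tensObj (H.tensObj X Y) Z) (Y := H.tensObj X (H.tensObj Y Z)) (α_ A B C).hom
      ((H.assocMod c A B C).hom.app ((X, Y), Z)) = H.assocHom X Y Z :=
  total_isoOfCocartesian_hom _ _ (H.cocartesian_assocHom X Y Z)

theorem total_rightUnitMod (X : c.pseudofunctor.obj ⟨A⟩) :
    c.total (X := H.tensObj X (H.unitFib c)) (Y := X) (fst A (𝟙_ 𝒮))
      ((H.rightUnitMod c A).hom.app (X, star)) = H.rightUnitHom X :=
  total_isoOfCocartesian_hom _ _ (H.cocartesian_rightUnitHom X)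

theorem total_leftUnitMod (X : c.pseudofunctor.obj ⟨A⟩) :
    c.total (X := H.tensObj (H.unitFib c) X) (Y := X) (snd (𝟙_ 𝒮) A)
      ((H.leftUnitMod c A).hom.app (star, X)) = H.leftUnitHom X :=
  total_isoOfCocartesian_hom _ _ (H.cocartesian_leftUnitHom X)

theorem total_swapMod (X : c.pseudofunctor.obj ⟨A⟩) (Y : c.pseudofunctor.obj ⟨B⟩) :
    c.total (X := H.tensObj X Y) (Y := H.tensObj Y X) (swap A B)
      ((H.swapMod c A B).hom.app (X, Y)) = H.swapHom X Y :=
  total_isoOfCocartesian_hom _ _ (H.cocartesian_swapHom X Y)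

/-- The lax symmetric monoidal structure given by the products. -/
noncomputable def laxSymmetricMonoidal (c : Cleavage P) :
    LaxSymmetricMonoidal c.pseudofunctor where
  R := H.strongTrans c
  R1 := H.unitTrans c
  ω A B C := H.assocMod c A B C
  ζ A := H.rightUnitMod c A
  ξ A := H.leftUnitMod c A
  θ A B := H.swapMod c A B
  -- Every axiom has the same proof: `total` evaluates each side to a composite of structure arrows
  -- of `𝒳`, and the two composites agree by naturality or coherence of the cartesian structure.
  ω_modification a b d X Y Z := total_injective <|
    ((total_paste_of (H.total_tensorCell_of (H.total_comparisonIso a b X Y) (total_id d Z))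
      (H.total_assocMod _ _ _)).trans (H.assocHom_naturality _ _ _)).trans
    (total_paste_of (H.total_assocMod X Y Z)
      (H.total_tensorCell_of (total_id a X) (H.total_comparisonIso b d Y Z))).symm
  ζ_modification a X := total_injective <|
    ((total_paste_of (H.total_tensorCell_of (total_id a X) (total_unitCell (H.unitFib c)))
      (H.total_rightUnitMod _)).trans (H.rightUnitHom_naturality _ _)).trans
    (total_paste_of (H.total_rightUnitMod X) (total_id a X)).symm
  ξ_modification a X := total_injective <|
    ((total_paste_of (H.total_tensorCell_of (total_unitCell (H.unitFib c)) (total_id a X))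
      (H.total_leftUnitMod _)).trans (H.leftUnitHom_naturality _ _)).trans
    (total_paste_of (H.total_leftUnitMod X) (total_id a X)).symm
  θ_modification a b X Y := total_injective <|
    ((total_paste_of (H.total_comparisonIso a b X Y) (H.total_swapMod _ _)).trans
      (H.swapHom_naturality _ _)).trans
    (total_paste_of (H.total_swapMod X Y) (H.total_comparisonIso b a Y X)).symm
  pentagon W X Y Z := total_injective <|
    ((total_paste_of (H.total_tensorCell_of (H.total_assocMod W X Y) (total_unitCell Z))
      (total_paste_of (H.total_assocMod _ _ _)
        (H.total_tensorCell_of (total_unitCell W) (H.total_assocMod X Y Z)))).trans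
      (H.assocHom_pentagon W X Y Z)).trans
    (total_paste_of (H.total_assocMod _ _ _) (H.total_assocMod _ _ _)).symm
  triangle X Y := total_injective <|
    ((H.total_tensorCell_of (H.total_rightUnitMod X) (total_unitCell Y)).trans
      (H.assocHom_triangle X Y)).trans
    (total_paste_of (H.total_assocMod _ _ _)
      (H.total_tensorCell_of (total_unitCell X) (H.total_leftUnitMod Y))).symm
  hexagon X Y Z := total_injective <|
    ((total_paste_of (H.total_assocMod X Y Z) (total_paste_of (H.total_swapMod _ _)
      (H.total_assocMod _ _ _))).trans (braid_hexagon _ _ _)).trans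
    (total_paste_of (H.total_tensorCell_of (H.total_swapMod X Y) (total_unitCell Z))
      (total_paste_of (H.total_assocMod _ _ _)
        (H.total_tensorCell_of (total_unitCell Y) (H.total_swapMod X Z)))).symm
  symmetry X Y := total_injective <|
    ((total_paste_of (H.total_swapMod X Y) (H.total_swapMod Y X)).trans (swap_swap _ _)).trans
    (total_unitCell (H.tensObj X Y)).symm

end

end IsCartesianMonoidalOpfibration

end

/-! ### Adjunctions between pseudofunctors, componentwise -/

section Adjunctions

open Bicategory
open scoped Pseudofunctor.StrongTrans

universe w₀ v₀ u₀
variable {B : Type u₀} [Bicategory.{w₀, v₀} B] {G₁ G₂ G₃ : Pseudofunctor B Cat.{v₂, u₂}}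
  {l : G₁ ⟶ G₂} {r : G₂ ⟶ G₁}

/-- The components of an adjunction in a 2-category of pseudofunctors. -/
def evalAdjunction (adj : l ⊣ r) (b : B) : l.app b ⊣ r.app b where
  unit := adj.unit.as.app b
  counit := adj.counit.as.app b
  left_triangle := by
    have h := congrArg (fun m => m.as.app b) adj.left_triangle
    simp [leftZigzag, bicategoricalComp] at h ⊢
    exact h
  right_triangle := by
    have h := congrArg (fun m => m.as.app b) adj.right_triangle
    simp [rightZigzag, bicategoricalComp] at h ⊢
    exact h

/-- An adjunction in a 2-category of pseudofunctors from adjunctions between the components whose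
units and counits are modifications. -/
def adjunctionOfComponents (unit : 𝟙 G₁ ⟶ l ≫ r) (counit : r ≫ l ⟶ 𝟙 G₂)
    (adj : ∀ b, l.app b ⊣ r.app b) (hη : ∀ b, unit.as.app b = (adj b).unit)
    (hε : ∀ b, counit.as.app b = (adj b).counit) : l ⊣ r where
  unit := unit
  counit := counit
  left_triangle := by
    -- Modifications are equal when their components are, so each triangle identity reduces to that
    -- of `adj b`.
    ext b : 1
    have h := (adj b).left_triangle
    rw [← hη, ← hε] at h
    simp [leftZigzag, bicategoricalComp] at h ⊢
    exact h
  right_triangle := by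
    ext b : 1
    have h := (adj b).right_triangle
    rw [← hη, ← hε] at h
    simp [rightZigzag, bicategoricalComp] at h ⊢
    exact h

theorem comp_naturality_app (η : G₁ ⟶ G₂) (θ : G₂ ⟶ G₃) {a b : B} (f : a ⟶ b) (Z : G₁.obj a) :
    ((η ≫ θ).naturality f).hom.toNatTrans.app Z =
      (θ.app b).toFunctor.map ((η.naturality f).hom.toNatTrans.app Z) ≫
        (θ.naturality f).hom.toNatTrans.app ((η.app a).toFunctor.obj Z) := by
  -- The three identities are components of the associators of `CAT` in the naturality cell of a
  -- composite.
  refine Eq.trans (b := 𝟙 _ ≫ (θ.app b).toFunctor.map ((η.naturality f).hom.toNatTrans.app Z) ≫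
    𝟙 _ ≫ (θ.naturality f).hom.toNatTrans.app ((η.app a).toFunctor.obj Z) ≫ 𝟙 _) rfl ?_
  refine (Category.id_comp _).trans (congrArg (_ ≫ ·) ?_)
  exact (Category.id_comp _).trans (Category.comp_id _)

theorem id_naturality_app {a b : B} (f : a ⟶ b) (Z : G₁.obj a) :
    ((𝟙 G₁ : G₁ ⟶ G₁).naturality f).hom.toNatTrans.app Z = 𝟙 _ :=
  Eq.trans (b := 𝟙 _ ≫ 𝟙 _) rfl (Category.comp_id _)

end Adjunctions

/-! ### Products as right adjoints of `L` and `L¹` -/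

section

variable {𝒮 : Type u₁} [Category.{v₁} 𝒮] [CartesianMonoidalCategory 𝒮]
  {𝒳 : Type u₂} [Category.{v₂} 𝒳] {P : 𝒳 ⥤ 𝒮} {c : Cleavage P}

open Cleavage

/-- The coherence isomorphism of `F` at `(a × b) ≫ π₁ = π₁ ≫ a`. -/
noncomputable def fstCell (c : Cleavage P) {A A' B B' : 𝒮} (a : A ⟶ A') (b : B ⟶ B')
    (Z : c.pseudofunctor.obj ⟨A ⊗ B⟩) :
    (fmap c.pseudofunctor (fst A' B')).obj ((fmap c.pseudofunctor (a ⊗ₘ b)).obj Z) ⟶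
      (fmap c.pseudofunctor a).obj ((fmap c.pseudofunctor (fst A B)).obj Z) :=
  (c.pseudofunctor.isoMapOfCommSq (CommSq.toLoc (t := a ⊗ₘ b) (l := fst A B) (r := fst A' B')
    (b := a) ⟨by simp⟩)).hom.toNatTrans.app Z

/-- The coherence isomorphism of `F` at `(a × b) ≫ π₂ = π₂ ≫ b`. -/
noncomputable def sndCell (c : Cleavage P) {A A' B B' : 𝒮} (a : A ⟶ A') (b : B ⟶ B')
    (Z : c.pseudofunctor.obj ⟨A ⊗ B⟩) :
    (fmap c.pseudofunctor (snd A' B')).obj ((fmap c.pseudofunctor (a ⊗ₘ b)).obj Z) ⟶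
      (fmap c.pseudofunctor b).obj ((fmap c.pseudofunctor (snd A B)).obj Z) :=
  (c.pseudofunctor.isoMapOfCommSq (CommSq.toLoc (t := a ⊗ₘ b) (l := snd A B) (r := snd A' B')
    (b := b) ⟨by simp⟩)).hom.toNatTrans.app Z

theorem lifting_fstCell {A A' B B' : 𝒮} (a : A ⟶ A') (b : B ⟶ B')
    (Z : c.pseudofunctor.obj ⟨A ⊗ B⟩) :
    c.lifting (a ⊗ₘ b) Z ≫ c.lifting (fst A' B') _ ≫ (c.fib _).map (fstCell c a b Z) =
      c.lifting (fst A B) Z ≫ c.lifting a _ :=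
  lifting_isoMapOfCommSq (CommSq.toLoc ⟨by simp⟩) Z

theorem lifting_fstCell_assoc {A A' B B' : 𝒮} (a : A ⟶ A') (b : B ⟶ B')
    (Z : c.pseudofunctor.obj ⟨A ⊗ B⟩)
    {T : 𝒳} (t : (c.fib _).obj
    ((fmap c.pseudofunctor a).obj ((fmap c.pseudofunctor (fst A B)).obj Z)) ⟶ T) :
    c.lifting (a ⊗ₘ b) Z ≫ c.lifting (fst A' B') _ ≫ (c.fib _).map (fstCell c a b Z) ≫ t =
      c.lifting (fst A B) Z ≫ c.lifting a _ ≫ t := by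
  simpa only [Category.assoc] using congrArg (· ≫ t) (lifting_fstCell a b Z)

theorem lifting_sndCell {A A' B B' : 𝒮} (a : A ⟶ A') (b : B ⟶ B')
    (Z : c.pseudofunctor.obj ⟨A ⊗ B⟩) :
    c.lifting (a ⊗ₘ b) Z ≫ c.lifting (snd A' B') _ ≫ (c.fib _).map (sndCell c a b Z) =
      c.lifting (snd A B) Z ≫ c.lifting b _ :=
  lifting_isoMapOfCommSq (CommSq.toLoc ⟨by simp⟩) Z

theorem lifting_sndCell_assoc {A A' B B' : 𝒮} (a : A ⟶ A') (b : B ⟶ B')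
    (Z : c.pseudofunctor.obj ⟨A ⊗ B⟩)
    {T : 𝒳} (t : (c.fib _).obj
    ((fmap c.pseudofunctor b).obj ((fmap c.pseudofunctor (snd A B)).obj Z)) ⟶ T) :
    c.lifting (a ⊗ₘ b) Z ≫ c.lifting (snd A' B') _ ≫ (c.fib _).map (sndCell c a b Z) ≫ t =
      c.lifting (snd A B) Z ≫ c.lifting b _ ≫ t := by
  simpa only [Category.assoc] using congrArg (· ≫ t) (lifting_sndCell a b Z)

namespace IsCartesianMonoidalOpfibration

variable [CartesianMonoidalCategory 𝒳] (H : IsCartesianMonoidalOpfibration P)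

section

variable {A B : 𝒮}

/-- The first projection between objects of the fibres. -/
noncomputable def fstHom (X : c.pseudofunctor.obj ⟨A⟩) (Y : c.pseudofunctor.obj ⟨B⟩) :
    (c.fib _).obj (H.tensObj X Y) ⟶ (c.fib _).obj X :=
  fst ((c.fib A).obj X) ((c.fib B).obj Y)

/-- The second projection between objects of the fibres. -/
noncomputable def sndHom (X : c.pseudofunctor.obj ⟨A⟩) (Y : c.pseudofunctor.obj ⟨B⟩) :
    (c.fib _).obj (H.tensObj X Y) ⟶ (c.fib _).obj Y :=
  snd ((c.fib A).obj X) ((c.fib B).obj Y)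

/-- The pairing of arrows into objects of the fibres. -/
noncomputable def pairHom {W : 𝒳} {X : c.pseudofunctor.obj ⟨A⟩} {Y : c.pseudofunctor.obj ⟨B⟩}
    (φ : W ⟶ (c.fib _).obj X) (ψ : W ⟶ (c.fib _).obj Y) : W ⟶ (c.fib _).obj (H.tensObj X Y) :=
  lift φ ψ

section

variable {W : 𝒳} {X : c.pseudofunctor.obj ⟨A⟩} {Y : c.pseudofunctor.obj ⟨B⟩}
  (φ : W ⟶ (c.fib _).obj X) (ψ : W ⟶ (c.fib _).obj Y)

@[simp]
theorem pairHom_fstHom : H.pairHom φ ψ ≫ H.fstHom X Y = φ := lift_fst φ ψ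

@[simp]
theorem pairHom_sndHom : H.pairHom φ ψ ≫ H.sndHom X Y = ψ := lift_snd φ ψ

theorem comp_pairHom {W' : 𝒳} (χ : W' ⟶ W) :
    χ ≫ H.pairHom φ ψ = H.pairHom (χ ≫ φ) (χ ≫ ψ) := comp_lift χ φ ψ

theorem pairHom_prodHom {A' B' : 𝒮} {X' : c.pseudofunctor.obj ⟨A'⟩}
    {Y' : c.pseudofunctor.obj ⟨B'⟩} (φ' : (c.fib _).obj X ⟶ (c.fib _).obj X')
    (ψ' : (c.fib _).obj Y ⟶ (c.fib _).obj Y') :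
    H.pairHom φ ψ ≫ H.prodHom φ' ψ' = H.pairHom (φ ≫ φ') (ψ ≫ ψ') := lift_map φ ψ φ' ψ'

@[simp]
theorem prodHom_fstHom {A' B' : 𝒮} {X' : c.pseudofunctor.obj ⟨A'⟩}
    {Y' : c.pseudofunctor.obj ⟨B'⟩} (φ' : (c.fib _).obj X ⟶ (c.fib _).obj X')
    (ψ' : (c.fib _).obj Y ⟶ (c.fib _).obj Y') :
    H.prodHom φ' ψ' ≫ H.fstHom X' Y' = H.fstHom X Y ≫ φ' := tensorHom_fst φ' ψ'

@[simp]
theorem prodHom_sndHom {A' B' : 𝒮} {X' : c.pseudofunctor.obj ⟨A'⟩}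
    {Y' : c.pseudofunctor.obj ⟨B'⟩} (φ' : (c.fib _).obj X ⟶ (c.fib _).obj X')
    (ψ' : (c.fib _).obj Y ⟶ (c.fib _).obj Y') :
    H.prodHom φ' ψ' ≫ H.sndHom X' Y' = H.sndHom X Y ≫ ψ' := tensorHom_snd φ' ψ'

theorem pairHom_fstHom_sndHom : H.pairHom (H.fstHom X Y) (H.sndHom X Y) = 𝟙 _ := lift_fst_snd

end

/-- The unit of the adjunction between `⟨F(π₁), F(π₂)⟩` and the product. -/
noncomputable def unitHom (Z : c.pseudofunctor.obj ⟨A ⊗ B⟩) :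
    Z ⟶ H.tensObj ((fmap c.pseudofunctor (fst A B)).obj Z)
      ((fmap c.pseudofunctor (snd A B)).obj Z) :=
  toFib (H.pairHom (c.lifting (fst A B) Z) (c.lifting (snd A B) Z))
    -- The pairing of the liftings of the two projections lies over `lift (fst A B) (snd A B)`,
    -- which is the identity, so it is vertical.
    (isHomLift_congr (CartesianMonoidalCategory.hom_ext _ _ (by simp) (by simp))
      (H.isHomLift_pair (Subtype.property (p := fun x => P.obj x = A) _)
        (Subtype.property (p := fun x => P.obj x = B) _)
        (cocartesian_lifting (fst A B) Z).toIsHomLift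
        (cocartesian_lifting (snd A B) Z).toIsHomLift))

@[simp]
theorem fib_map_unitHom (Z : c.pseudofunctor.obj ⟨A ⊗ B⟩) :
    (c.fib _).map (H.unitHom Z) = H.pairHom (c.lifting (fst A B) Z) (c.lifting (snd A B) Z) :=
  rfl

/-- The first component of the counit. -/
noncomputable def counitFst (X : c.pseudofunctor.obj ⟨A⟩) (Y : c.pseudofunctor.obj ⟨B⟩) :
    (fmap c.pseudofunctor (fst A B)).obj (H.tensObj X Y) ⟶ X :=
  descend (fst A B) (H.fstHom X Y) (H.isHomLift_fst X.2 Y.2)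

/-- The second component of the counit. -/
noncomputable def counitSnd (X : c.pseudofunctor.obj ⟨A⟩) (Y : c.pseudofunctor.obj ⟨B⟩) :
    (fmap c.pseudofunctor (snd A B)).obj (H.tensObj X Y) ⟶ Y :=
  descend (snd A B) (H.sndHom X Y) (H.isHomLift_snd X.2 Y.2)

@[simp]
theorem lifting_counitFst (X : c.pseudofunctor.obj ⟨A⟩) (Y : c.pseudofunctor.obj ⟨B⟩) :
    c.lifting (fst A B) (H.tensObj X Y) ≫ (c.fib _).map (H.counitFst X Y) = H.fstHom X Y :=
  total_descend ..

theorem lifting_counitFst_assoc (X : c.pseudofunctor.obj ⟨A⟩) (Y : c.pseudofunctor.obj ⟨B⟩)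
    {T : 𝒳} (t : (c.fib _).obj X ⟶ T) :
    c.lifting (fst A B) (H.tensObj X Y) ≫ (c.fib _).map (H.counitFst X Y) ≫ t =
      H.fstHom X Y ≫ t := by
  simpa only [Category.assoc] using congrArg (· ≫ t) (H.lifting_counitFst X Y)

@[simp]
theorem lifting_counitSnd (X : c.pseudofunctor.obj ⟨A⟩) (Y : c.pseudofunctor.obj ⟨B⟩) :
    c.lifting (snd A B) (H.tensObj X Y) ≫ (c.fib _).map (H.counitSnd X Y) = H.sndHom X Y :=
  total_descend ..

theorem lifting_counitSnd_assoc (X : c.pseudofunctor.obj ⟨A⟩) (Y : c.pseudofunctor.obj ⟨B⟩)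
    {T : 𝒳} (t : (c.fib _).obj Y ⟶ T) :
    c.lifting (snd A B) (H.tensObj X Y) ≫ (c.fib _).map (H.counitSnd X Y) ≫ t =
      H.sndHom X Y ≫ t := by
  simpa only [Category.assoc] using congrArg (· ≫ t) (H.lifting_counitSnd X Y)

theorem unitHom_naturality {Z Z' : c.pseudofunctor.obj ⟨A ⊗ B⟩} (u : Z ⟶ Z') :
    u ≫ H.unitHom Z' = H.unitHom Z ≫ H.tensMap ((fmap c.pseudofunctor (fst A B)).map u)
      ((fmap c.pseudofunctor (snd A B)).map u) := by
  apply fib_map_injective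
  rw [Functor.map_comp, Functor.map_comp, fib_map_unitHom, fib_map_unitHom, fib_map_tensMap,
    comp_pairHom, pairHom_prodHom, lifting_map, lifting_map]

theorem counitFst_naturality {X X' : c.pseudofunctor.obj ⟨A⟩} {Y Y' : c.pseudofunctor.obj ⟨B⟩}
    (u : X ⟶ X') (v : Y ⟶ Y') :
    (fmap c.pseudofunctor (fst A B)).map (H.tensMap u v) ≫ H.counitFst X' Y' =
      H.counitFst X Y ≫ u := by
  apply total_injective
  rw [total_map_comp, total_comp, fib_map_tensMap, total, total, lifting_counitFst,
    lifting_counitFst, prodHom_fstHom]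

theorem map_unitHom_comp_counitFst (Z : c.pseudofunctor.obj ⟨A ⊗ B⟩) :
    (fmap c.pseudofunctor (fst A B)).map (H.unitHom Z) ≫ H.counitFst _ _ = 𝟙 _ := by
  apply total_injective
  rw [total_map_comp, total_id, fib_map_unitHom, total, lifting_counitFst, pairHom_fstHom]

/-- The modification condition for the counit, in its first component. After cancelling the liftings
of the projection and of `a ⊗ₘ b`, both sides are the first projection followed by the lifting of
`a`. -/
theorem counitFst_comparison {A' B' : 𝒮} (a : A ⟶ A') (b : B ⟶ B')
    (X : c.pseudofunctor.obj ⟨A⟩) (Y : c.pseudofunctor.obj ⟨B⟩) :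
    (fmap c.pseudofunctor (fst A' B')).map (H.comparisonIso a b X Y).hom ≫ H.counitFst _ _ =
      fstCell c a b _ ≫ (fmap c.pseudofunctor a).map (H.counitFst X Y) := by
  apply total_injective
  apply eq_of_cocartesian_comp (cocartesian_lifting (a ⊗ₘ b) (H.tensObj X Y))
    (isHomLift_total _ _) (isHomLift_total _ _)
  rw [total_map_comp, total, lifting_counitFst, ← Category.assoc]
  refine (congrArg (· ≫ _) (H.total_comparisonIso a b X Y)).trans ?_
  rw [prodHom_fstHom, total, Functor.map_comp, lifting_fstCell_assoc, lifting_map,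
    lifting_counitFst_assoc]

theorem counitSnd_naturality {X X' : c.pseudofunctor.obj ⟨A⟩} {Y Y' : c.pseudofunctor.obj ⟨B⟩}
    (u : X ⟶ X') (v : Y ⟶ Y') :
    (fmap c.pseudofunctor (snd A B)).map (H.tensMap u v) ≫ H.counitSnd X' Y' =
      H.counitSnd X Y ≫ v := by
  apply total_injective
  rw [total_map_comp, total_comp, fib_map_tensMap, total, total, lifting_counitSnd,
    lifting_counitSnd, prodHom_sndHom]

theorem map_unitHom_comp_counitSnd (Z : c.pseudofunctor.obj ⟨A ⊗ B⟩) :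
    (fmap c.pseudofunctor (snd A B)).map (H.unitHom Z) ≫ H.counitSnd _ _ = 𝟙 _ := by
  apply total_injective
  rw [total_map_comp, total_id, fib_map_unitHom, total, lifting_counitSnd, pairHom_sndHom]

theorem counitSnd_comparison {A' B' : 𝒮} (a : A ⟶ A') (b : B ⟶ B')
    (X : c.pseudofunctor.obj ⟨A⟩) (Y : c.pseudofunctor.obj ⟨B⟩) :
    (fmap c.pseudofunctor (snd A' B')).map (H.comparisonIso a b X Y).hom ≫ H.counitSnd _ _ =
      sndCell c a b _ ≫ (fmap c.pseudofunctor b).map (H.counitSnd X Y) := by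
  apply total_injective
  apply eq_of_cocartesian_comp (cocartesian_lifting (a ⊗ₘ b) (H.tensObj X Y))
    (isHomLift_total _ _) (isHomLift_total _ _)
  rw [total_map_comp, total, lifting_counitSnd, ← Category.assoc]
  refine (congrArg (· ≫ _) (H.total_comparisonIso a b X Y)).trans ?_
  rw [prodHom_sndHom, total, Functor.map_comp, lifting_sndCell_assoc, lifting_map,
    lifting_counitSnd_assoc]

theorem unitHom_comp_tensMap (X : c.pseudofunctor.obj ⟨A⟩) (Y : c.pseudofunctor.obj ⟨B⟩) :
    H.unitHom (H.tensObj X Y) ≫ H.tensMap (H.counitFst X Y) (H.counitSnd X Y) = 𝟙 _ := by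
  apply fib_map_injective
  rw [Functor.map_comp, fib_map_unitHom, fib_map_tensMap, pairHom_prodHom, lifting_counitFst,
    lifting_counitSnd, pairHom_fstHom_sndHom, CategoryTheory.Functor.map_id]

/-- The modification condition for the unit. Along the lifting of `a ⊗ₘ b` both sides pair the
composite liftings `fst` then `a`, and `snd` then `b`. -/
theorem unitHom_comparison {A' B' : 𝒮} (a : A ⟶ A') (b : B ⟶ B')
    (Z : c.pseudofunctor.obj ⟨A ⊗ B⟩) :
    H.unitHom ((fmap c.pseudofunctor (a ⊗ₘ b)).obj Z) ≫
        H.tensMap (fstCell c a b Z) (sndCell c a b Z) =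
      (fmap c.pseudofunctor (a ⊗ₘ b)).map (H.unitHom Z) ≫ (H.comparisonIso a b _ _).hom := by
  apply total_injective
  rw [total_map_comp, total_comparisonIso, fib_map_unitHom, pairHom_prodHom, total,
    Functor.map_comp, fib_map_unitHom, fib_map_tensMap, pairHom_prodHom, comp_pairHom,
    lifting_fstCell, lifting_sndCell]

/-- The adjunction between `⟨F(π₁), F(π₂)⟩` and the product. -/
noncomputable def tensAdjunction (c : Cleavage P) (A B : 𝒮) :
    Functor.prod' (fmap c.pseudofunctor (fst A B)) (fmap c.pseudofunctor (snd A B)) ⊣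
      H.tensFunctor c A B :=
  Adjunction.mkOfUnitCounit
    { unit :=
        { app := fun Z => H.unitHom Z
          naturality := fun _ _ u => H.unitHom_naturality u }
      counit :=
        { app := fun X => (H.counitFst X.1 X.2, H.counitSnd X.1 X.2)
          naturality := fun _ _ u => Prod.ext (H.counitFst_naturality u.1 u.2)
            (H.counitSnd_naturality u.1 u.2) }
      left_triangle := by
        ext Z
        · exact (congrArg (_ ≫ ·) (Category.id_comp _)).trans (H.map_unitHom_comp_counitFst Z)
        · exact (congrArg (_ ≫ ·) (Category.id_comp _)).trans (H.map_unitHom_comp_counitSnd Z)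
      right_triangle := by
        ext X
        exact (congrArg (_ ≫ ·) (Category.id_comp _)).trans (H.unitHom_comp_tensMap X.1 X.2) }

end

section

open Bicategory
open scoped Pseudofunctor.StrongTrans

/-- The naturality cell of `strongTrans` is the inverse of the comparison, so the modification
conditions are needed solved for that inverse. -/
theorem unitHom_comparison_inv {A A' B B' : 𝒮} (a : A ⟶ A') (b : B ⟶ B')
    (Z : c.pseudofunctor.obj ⟨A ⊗ B⟩) :
    H.unitHom ((fmap c.pseudofunctor (a ⊗ₘ b)).obj Z) ≫
        H.tensMap (fstCell c a b Z) (sndCell c a b Z) ≫ (H.comparisonIso a b _ _).inv =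
      (fmap c.pseudofunctor (a ⊗ₘ b)).map (H.unitHom Z) := by
  rw [← Category.assoc, unitHom_comparison, Category.assoc, Iso.hom_inv_id, Category.comp_id]

theorem counitFst_comparison_inv {A A' B B' : 𝒮} (a : A ⟶ A') (b : B ⟶ B')
    (X : c.pseudofunctor.obj ⟨A⟩) (Y : c.pseudofunctor.obj ⟨B⟩) :
    H.counitFst _ _ = (fmap c.pseudofunctor (fst A' B')).map (H.comparisonIso a b X Y).inv ≫
      fstCell c a b _ ≫ (fmap c.pseudofunctor a).map (H.counitFst X Y) := by
  rw [← counitFst_comparison, ← Functor.map_comp_assoc, Iso.inv_hom_id,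
    CategoryTheory.Functor.map_id, Category.id_comp]

theorem counitSnd_comparison_inv {A A' B B' : 𝒮} (a : A ⟶ A') (b : B ⟶ B')
    (X : c.pseudofunctor.obj ⟨A⟩) (Y : c.pseudofunctor.obj ⟨B⟩) :
    H.counitSnd _ _ = (fmap c.pseudofunctor (snd A' B')).map (H.comparisonIso a b X Y).inv ≫
      sndCell c a b _ ≫ (fmap c.pseudofunctor b).map (H.counitSnd X Y) := by
  rw [← counitSnd_comparison, ← Functor.map_comp_assoc, Iso.inv_hom_id,
    CategoryTheory.Functor.map_id, Category.id_comp]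

/-- The right adjoint of `L` given by the products. -/
noncomputable def LAdjunction (c : Cleavage P) :
    Bicategory.Adjunction (a := tensorPseudo c.pseudofunctor) (b := prodPseudo c.pseudofunctor)
      (L c.pseudofunctor) (H.strongTrans c) :=
  adjunctionOfComponents (l := L c.pseudofunctor) (r := H.strongTrans c)
    ⟨{ app := fun A => (H.tensAdjunction c A.as.1 A.as.2).toCat.unit
       naturality := fun {A A'} f => by
        ext Z
        -- The cell of the composite of `L` and the product is the product of the two coherence
        -- cells of `L` followed by the inverse comparison; the cell of the identity transformation
        -- is an identity.
        refine (congrArg (_ ≫ ·) (comp_naturality_app (G₁ := tensorPseudo c.pseudofunctor)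
          (L c.pseudofunctor) (H.strongTrans c) f Z)).trans ?_
        refine Eq.trans ?_ (congrArg (· ≫ _)
          (id_naturality_app (G₁ := tensorPseudo c.pseudofunctor) f Z)).symm
        exact (H.unitHom_comparison_inv f.as.1 f.as.2 Z).trans (Category.id_comp _).symm }⟩
    ⟨{ app := fun A => (H.tensAdjunction c A.as.1 A.as.2).toCat.counit
       naturality := fun {A A'} f => by
        ext X
        refine (congrArg (_ ≫ ·)
          (id_naturality_app (G₁ := prodPseudo c.pseudofunctor) f X)).trans ?_
        refine (Category.comp_id _).trans (Eq.trans ?_ (congrArg (· ≫ _)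
          (comp_naturality_app (G₁ := prodPseudo c.pseudofunctor)
            (H.strongTrans c) (L c.pseudofunctor) f X)).symm)
        refine Eq.trans ?_ (Category.assoc _ _ _).symm
        exact Prod.ext (H.counitFst_comparison_inv f.as.1 f.as.2 X.1 X.2)
          (H.counitSnd_comparison_inv f.as.1 f.as.2 X.1 X.2) }⟩
    (fun A => (H.tensAdjunction c A.as.1 A.as.2).toCat) (fun _ => rfl) (fun _ => rfl)

/-- The right adjoint of `L¹` given by the terminal object. -/
noncomputable def L1Adjunction (c : Cleavage P) :
    Bicategory.Adjunction (a := pointPseudo c.pseudofunctor) (b := unitPseudo.{v₂, u₂})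
      (L1 c.pseudofunctor) (H.unitTrans c) :=
  -- All equations hold because arrows into the terminal object, and arrows of the terminal
  -- category, are unique.
  let adj : (L1 c.pseudofunctor).app ⟨⟨⟨⟩⟩⟩ ⊣ (H.unitTrans c).app ⟨⟨⟨⟩⟩⟩ :=
    (Adjunction.mkOfUnitCounit
    (F := (Cat.chosenTerminalIsTerminal.from (c.pseudofunctor.obj ⟨𝟙_ 𝒮⟩)).toFunctor)
    (G := (Functor.const Cat.chosenTerminal.{v₂, u₂}).obj (H.unitFib c))
    { unit :=
        { app := fun Z => toFib (toUnit ((c.fib _).obj Z))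
            (isHomLift_congr (toUnit_unique _ _) (isHomLift_toUnit (P := P) Z.2 H.obj_unit _))
          naturality := fun _ _ _ => H.unitFib_hom_ext (Iso.refl (H.unitFib c)) _ _ }
      counit :=
        { app := fun _ => eqToHom rfl
          naturality := fun _ _ _ => terminal_hom_ext _ _ }
      left_triangle := by ext Z; exact terminal_hom_ext _ _
      right_triangle := by ext Z; exact H.unitFib_hom_ext (Iso.refl (H.unitFib c)) _ _ }).toCat
  adjunctionOfComponents (l := L1 c.pseudofunctor) (r := H.unitTrans c)
    ⟨{ app := fun _ => adj.unit
       naturality := fun f => by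
        ext Z
        exact H.unitFib_hom_ext (mapIdIso (H.unitFib c)) _ _ }⟩
    ⟨{ app := fun _ => adj.counit
       naturality := fun f => by ext Z; exact terminal_hom_ext _ _ }⟩
    (fun _ => adj) (fun _ => rfl) (fun _ => rfl)

theorem L1HasRightAdjoint_pseudofunctor (H : IsCartesianMonoidalOpfibration P) (c : Cleavage P) :
    L1HasRightAdjoint c.pseudofunctor :=
  Bicategory.IsLeftAdjoint.mk (H.L1Adjunction c)

theorem LHasRightAdjoint_pseudofunctor (H : IsCartesianMonoidalOpfibration P) (c : Cleavage P) :
    LHasRightAdjoint c.pseudofunctor :=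
  Bicategory.IsLeftAdjoint.mk (H.LAdjunction c)

end

end IsCartesianMonoidalOpfibration

end

/-! ### Factoring arrows over a composite -/

section

variable {𝒮 : Type u₁} [Category.{v₁} 𝒮] {𝒳 : Type u₂} [Category.{v₂} 𝒳] {P : 𝒳 ⥤ 𝒮}
  {c : Cleavage P}

open Cleavage

theorem Cleavage.obj_fib {A : 𝒮} (X : c.pseudofunctor.obj ⟨A⟩) : P.obj ((c.fib A).obj X) = A :=
  Subtype.property (p := fun x => P.obj x = A) X

theorem Cleavage.exists_total_eq {A A' : 𝒮} {f : A ⟶ A'} {X : c.pseudofunctor.obj ⟨A⟩}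
    {Y : c.pseudofunctor.obj ⟨A'⟩} (φ : (c.fib A).obj X ⟶ (c.fib A').obj Y)
    (hφ : P.IsHomLift f φ) : ∃ u, c.total f u = φ :=
  ⟨descend f φ hφ, total_descend f φ hφ⟩

/-- An arrow over a composite factors through the lifting of the first arrow. -/
theorem Cleavage.exists_lifting_comp_total {A A' A'' : 𝒮} {f : A ⟶ A'} {g : A' ⟶ A''}
    {X : c.pseudofunctor.obj ⟨A⟩} {Y : c.pseudofunctor.obj ⟨A''⟩}
    (φ : (c.fib A).obj X ⟶ (c.fib A'').obj Y) (hφ : P.IsHomLift (f ≫ g) φ) :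
    ∃ u : (fmap c.pseudofunctor g).obj ((fmap c.pseudofunctor f).obj X) ⟶ Y,
      c.lifting f X ≫ c.total g u = φ := by
  have := cocartesian_lifting f X
  obtain ⟨u, hu⟩ := exists_total_eq (c := c) (f := g) (X := (fmap c.pseudofunctor f).obj X) (Y := Y)
    (IsStronglyCocartesian.map P f (c.lifting f X) (rfl : f ≫ g = f ≫ g) φ)
    (IsStronglyCocartesian.map_isHomLift P f (c.lifting f X) rfl φ)
  exact ⟨u, hu ▸ IsStronglyCocartesian.fac P f (c.lifting f X) rfl φ⟩

/-- This brings a composite into the form of a lifting followed by an arrow over `g`, to which the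
existence and uniqueness of factorizations apply. -/
theorem Cleavage.total_comp_total {A A' A'' : 𝒮} {f : A ⟶ A'} {g : A' ⟶ A''}
    {X : c.pseudofunctor.obj ⟨A⟩} {Y : c.pseudofunctor.obj ⟨A'⟩} {Z : c.pseudofunctor.obj ⟨A''⟩}
    (u : (fmap c.pseudofunctor f).obj X ⟶ Y) (v : (fmap c.pseudofunctor g).obj Y ⟶ Z) :
    c.total f u ≫ c.total g v =
      c.lifting f X ≫ c.total g ((fmap c.pseudofunctor g).map u ≫ v) := by
  rw [total_map_comp, total, Category.assoc]

/-- An arrow over a composite factors uniquely through the lifting of the first arrow. -/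
theorem Cleavage.lifting_comp_total_injective {A A' A'' : 𝒮} {f : A ⟶ A'} {g : A' ⟶ A''}
    {X : c.pseudofunctor.obj ⟨A⟩} {Y : c.pseudofunctor.obj ⟨A''⟩}
    {u v : (fmap c.pseudofunctor g).obj ((fmap c.pseudofunctor f).obj X) ⟶ Y}
    (h : c.lifting f X ≫ c.total g u = c.lifting f X ≫ c.total g v) : u = v :=
  total_injective (eq_of_cocartesian_comp (cocartesian_lifting f X) (isHomLift_total g u)
    (isHomLift_total g v) h)

end

/-! ### Products from right adjoints of `L` and `L¹` -/

section

variable {𝒮 : Type u₁} [Category.{v₁} 𝒮] [CartesianMonoidalCategory 𝒮]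
  {𝒳 : Type u₂} [Category.{v₂} 𝒳] {P : 𝒳 ⥤ 𝒮} {c : Cleavage P}

open Cleavage Bicategory
open scoped Pseudofunctor.StrongTrans

section

variable {R : prodPseudo c.pseudofunctor ⟶ tensorPseudo c.pseudofunctor}
  (adj : Bicategory.Adjunction (a := tensorPseudo c.pseudofunctor)
    (b := prodPseudo c.pseudofunctor) (L c.pseudofunctor) R)

/-- The components of an adjunction between `L` and `R`. -/
noncomputable def adjunctionApp (A B : 𝒮) :
    Functor.prod' (fmap c.pseudofunctor (fst A B)) (fmap c.pseudofunctor (snd A B)) ⊣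
      tensorFunctor R A B :=
  Adjunction.ofCat (evalAdjunction adj ⟨(A, B)⟩)

variable {A B : 𝒮} (X : c.pseudofunctor.obj ⟨A⟩) (Y : c.pseudofunctor.obj ⟨B⟩)

/-- The first component of the counit. -/
noncomputable def counitApp₁ : (fmap c.pseudofunctor (fst A B)).obj (tens R X Y) ⟶ X :=
  ((adjunctionApp adj A B).counit.app (X, Y)).1

/-- The second component of the counit. -/
noncomputable def counitApp₂ : (fmap c.pseudofunctor (snd A B)).obj (tens R X Y) ⟶ Y :=
  ((adjunctionApp adj A B).counit.app (X, Y)).2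

/-- The hom-bijection of the adjunction, split into components because arrows of `F(A) × F(B)` are
pairs. It is the universal property of the product tested on vertical arrows only. -/
theorem exists_unique_of_adjunction {Z : c.pseudofunctor.obj ⟨A ⊗ B⟩}
    (u : (fmap c.pseudofunctor (fst A B)).obj Z ⟶ X)
    (v : (fmap c.pseudofunctor (snd A B)).obj Z ⟶ Y) :
    ∃! k : Z ⟶ tens R X Y, (fmap c.pseudofunctor (fst A B)).map k ≫ counitApp₁ adj X Y = u ∧
      (fmap c.pseudofunctor (snd A B)).map k ≫ counitApp₂ adj X Y = v := by
  have h (k : Z ⟶ tens R X Y) : ((adjunctionApp adj A B).homEquiv Z (X, Y)).symm k = (u, v) ↔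
      (fmap c.pseudofunctor (fst A B)).map k ≫ counitApp₁ adj X Y = u ∧
      (fmap c.pseudofunctor (snd A B)).map k ≫ counitApp₂ adj X Y = v := by
    rw [Adjunction.homEquiv_counit]
    exact Prod.ext_iff
  refine ⟨(adjunctionApp adj A B).homEquiv Z (X, Y) (u, v), (h _).1 (Equiv.symm_apply_apply _ _),
    fun k hk => ?_⟩
  exact ((Equiv.symm_apply_eq _).1 ((h k).2 hk))

/-- The counit is a modification from `R ≫ L` to the identity. The cell of the composite is that of
`R` followed by that of `L`; composing with `comparison`, the inverse of the cell of `R`, cancels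
the former. -/
theorem counit_comparison {A' B' : 𝒮} (a : A ⟶ A') (b : B ⟶ B') :
    (Functor.prod' (fmap c.pseudofunctor (fst A' B')) (fmap c.pseudofunctor (snd A' B'))).map
        (comparison R a b X Y) ≫ (adjunctionApp adj A' B').counit.app
          ((fmap c.pseudofunctor a).obj X, (fmap c.pseudofunctor b).obj Y) =
      ((fstCell c a b (tens R X Y), sndCell c a b (tens R X Y)) : (_, _) ⟶ (_, _)) ≫
        ((fmap c.pseudofunctor a).prod (fmap c.pseudofunctor b)).map
          ((adjunctionApp adj A B).counit.app (X, Y)) := by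
  let f : (⟨(A, B)⟩ : LocallyDiscrete (𝒮 × 𝒮)) ⟶ ⟨(A', B')⟩ :=
    Quiver.Hom.toLoc ((a, b) : (A, B) ⟶ (A', B'))
  have h := congrArg (fun t => t.toNatTrans.app (X, Y)) (adj.counit.as.naturality f)
  have h' : (adjunctionApp adj A' B').counit.app
        ((fmap c.pseudofunctor a).obj X, (fmap c.pseudofunctor b).obj Y) =
      ((Functor.prod' (fmap c.pseudofunctor (fst A' B')) (fmap c.pseudofunctor (snd A' B'))).map
        ((R.naturality f).hom.toNatTrans.app (X, Y)) ≫
        ((fstCell c a b (tens R X Y), sndCell c a b (tens R X Y)) : (_, _) ⟶ (_, _))) ≫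
        ((fmap c.pseudofunctor a).prod (fmap c.pseudofunctor b)).map
          ((adjunctionApp adj A B).counit.app (X, Y)) := by
    refine ((Category.comp_id _).symm.trans
      (congrArg (_ ≫ ·) (id_naturality_app (G₁ := prodPseudo c.pseudofunctor) f (X, Y)).symm)).trans
      (h.trans (congrArg (· ≫ _) ?_))
    exact comp_naturality_app R (L c.pseudofunctor) f (X, Y)
  refine (congrArg (_ ≫ ·) h').trans ((Category.assoc _ _ _).symm.trans
    (congrArg (· ≫ _) ((Category.assoc _ _ _).symm.trans
    ((congrArg (· ≫ _) ?_).trans (Category.id_comp _)))))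
  refine (CategoryTheory.Functor.map_comp _ _ _).symm.trans
    ((congrArg _ ?_).trans (CategoryTheory.Functor.map_id _ _))
  exact congrArg (fun t => t.toNatTrans.app (X, Y)) (R.naturality f).inv_hom_id

theorem counitApp₁_comparison {A' B' : 𝒮} (a : A ⟶ A') (b : B ⟶ B') :
    (fmap c.pseudofunctor (fst A' B')).map (comparison R a b X Y) ≫ counitApp₁ adj _ _ =
      fstCell c a b _ ≫ (fmap c.pseudofunctor a).map (counitApp₁ adj X Y) :=
  congrArg Prod.fst (counit_comparison adj X Y a b)

theorem counitApp₂_comparison {A' B' : 𝒮} (a : A ⟶ A') (b : B ⟶ B') :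
    (fmap c.pseudofunctor (snd A' B')).map (comparison R a b X Y) ≫ counitApp₂ adj _ _ =
      sndCell c a b _ ≫ (fmap c.pseudofunctor b).map (counitApp₂ adj X Y) :=
  congrArg Prod.snd (counit_comparison adj X Y a b)

/-- The modification condition translated to `𝒳`: `R^{(a,b)}` corresponds to an arrow with the first
projection of the product of the liftings. -/
theorem total_comparison_comp₁ {A' B' : 𝒮} (a : A ⟶ A') (b : B ⟶ B') :
    c.total (a ⊗ₘ b) (comparison R a b X Y) ≫ c.total (fst A' B') (counitApp₁ adj _ _) =
      c.total (fst A B) (counitApp₁ adj X Y) ≫ c.lifting a X := by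
  have h := total_map_comp (c := c) (fst A' B') (comparison R a b X Y) (counitApp₁ adj _ _)
  rw [counitApp₁_comparison] at h
  rw [total, Category.assoc, ← h, total, Functor.map_comp, lifting_fstCell_assoc, lifting_map,
    total, Category.assoc]

theorem total_comparison_comp₂ {A' B' : 𝒮} (a : A ⟶ A') (b : B ⟶ B') :
    c.total (a ⊗ₘ b) (comparison R a b X Y) ≫ c.total (snd A' B') (counitApp₂ adj _ _) =
      c.total (snd A B) (counitApp₂ adj X Y) ≫ c.lifting b Y := by
  have h := total_map_comp (c := c) (snd A' B') (comparison R a b X Y) (counitApp₂ adj _ _)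
  rw [counitApp₂_comparison] at h
  rw [total, Category.assoc, ← h, total, Functor.map_comp, lifting_sndCell_assoc, lifting_map,
    total, Category.assoc]

/-- If `φ` and `ψ` lie over `f` and `g`, both factor through the lifting of `lift f g`, by arrows
over the two projections. From the pushed-forward object the vertical universal property applies. -/
theorem exists_pairing {C : 𝒮} {W : c.pseudofunctor.obj ⟨C⟩}
    (φ : (c.fib C).obj W ⟶ (c.fib A).obj X) (ψ : (c.fib C).obj W ⟶ (c.fib B).obj Y) :
    ∃ m : (c.fib C).obj W ⟶ (c.fib _).obj (tens R X Y),
      m ≫ c.total (fst A B) (counitApp₁ adj X Y) = φ ∧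
      m ≫ c.total (snd A B) (counitApp₂ adj X Y) = ψ := by
  obtain ⟨f, hf⟩ : ∃ f : C ⟶ A, P.IsHomLift f φ := exists_isHomLift φ (obj_fib W) (obj_fib X)
  obtain ⟨g, hg⟩ : ∃ g : C ⟶ B, P.IsHomLift g ψ := exists_isHomLift ψ (obj_fib W) (obj_fib Y)
  obtain ⟨u, rfl⟩ := exists_lifting_comp_total (f := lift f g) (g := fst A B) φ
    ((lift_fst f g).symm ▸ hf)
  obtain ⟨v, rfl⟩ := exists_lifting_comp_total (f := lift f g) (g := snd A B) ψ
    ((lift_snd f g).symm ▸ hg)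
  obtain ⟨k, ⟨h₁, h₂⟩, -⟩ := exists_unique_of_adjunction adj X Y u v
  exact ⟨c.total (lift f g) k, by rw [total_comp_total, h₁], by rw [total_comp_total, h₂]⟩

theorem pairing_ext {C : 𝒮} {W : c.pseudofunctor.obj ⟨C⟩}
    {m m' : (c.fib C).obj W ⟶ (c.fib _).obj (tens R X Y)}
    (h₁ : m ≫ c.total (fst A B) (counitApp₁ adj X Y) =
      m' ≫ c.total (fst A B) (counitApp₁ adj X Y))
    (h₂ : m ≫ c.total (snd A B) (counitApp₂ adj X Y) =
      m' ≫ c.total (snd A B) (counitApp₂ adj X Y)) : m = m' := by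
  obtain ⟨f, hf⟩ : ∃ f : C ⟶ A ⊗ B, P.IsHomLift f m :=
    exists_isHomLift m (obj_fib W) (obj_fib (tens R X Y))
  obtain ⟨f', hf'⟩ : ∃ f : C ⟶ A ⊗ B, P.IsHomLift f m' :=
    exists_isHomLift m' (obj_fib W) (obj_fib (tens R X Y))
  have t₁ := isHomLift_total (c := c) (fst A B) (counitApp₁ adj X Y)
  have t₂ := isHomLift_total (c := c) (snd A B) (counitApp₂ adj X Y)
  -- The base arrows agree after each projection of `A ⊗ B`, hence agree; only then can `m` and `m'`
  -- be compared as vertical arrows.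
  obtain rfl : f = f' := by
    apply CartesianMonoidalCategory.hom_ext
    · exact isHomLift_unique (P := P) (m ≫ c.total (fst A B) (counitApp₁ adj X Y)) inferInstance
        (h₁ ▸ inferInstance)
    · exact isHomLift_unique (P := P) (m ≫ c.total (snd A B) (counitApp₂ adj X Y)) inferInstance
        (h₂ ▸ inferInstance)
  obtain ⟨k, rfl⟩ := exists_total_eq m hf
  obtain ⟨k', rfl⟩ := exists_total_eq m' hf'
  simp only [total_comp_total] at h₁ h₂
  exact congrArg _ ((exists_unique_of_adjunction adj X Y _ _).unique
    ⟨lifting_comp_total_injective h₁, lifting_comp_total_injective h₂⟩ ⟨rfl, rfl⟩)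

end

section

variable {R1 : unitPseudo ⟶ pointPseudo c.pseudofunctor}

/-- The adjunction between the functors to and from the terminal category. -/
noncomputable def unitAdjunctionApp (adj1 : Bicategory.Adjunction (a := pointPseudo c.pseudofunctor)
    (b := unitPseudo.{v₂, u₂}) (L1 c.pseudofunctor) R1) :
    CategoryTheory.Adjunction ((L1 c.pseudofunctor).app ⟨⟨⟨⟩⟩⟩).toFunctor
      (unitFunctor (F := c.pseudofunctor) R1) :=
  Adjunction.ofCat (evalAdjunction adj1 ⟨⟨⟨⟩⟩⟩)

theorem nonempty_unique_hom_of_unitAdjunction (adj1 : Bicategory.Adjunction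
    (a := pointPseudo c.pseudofunctor) (b := unitPseudo.{v₂, u₂}) (L1 c.pseudofunctor) R1)
    (Z : c.pseudofunctor.obj ⟨𝟙_ 𝒮⟩) : Nonempty (Unique (Z ⟶ unitObj (F := c.pseudofunctor) R1)) :=
  ⟨⟨⟨(unitAdjunctionApp adj1).homEquiv Z star (eqToHom rfl)⟩, fun _ =>
    (Equiv.symm_apply_eq _).1 (terminal_hom_ext _ _)⟩⟩

/-- Every arrow from `W` to the unit lies over `toUnit C`, so it corresponds to a vertical arrow out
of the push-forward of `W` along `toUnit C`, and the adjunction provides exactly one. -/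
theorem nonempty_unique_hom_unitObj (adj1 : Bicategory.Adjunction
    (a := pointPseudo c.pseudofunctor) (b := unitPseudo.{v₂, u₂}) (L1 c.pseudofunctor) R1)
    {C : 𝒮} (W : c.pseudofunctor.obj ⟨C⟩) :
    Nonempty (Unique ((c.fib C).obj W ⟶ (c.fib _).obj (unitObj (F := c.pseudofunctor) R1))) := by
  obtain ⟨_⟩ := nonempty_unique_hom_of_unitAdjunction adj1 ((fmap c.pseudofunctor (toUnit C)).obj W)
  refine ⟨⟨⟨c.total (toUnit C) default⟩, fun φ => ?_⟩⟩
  obtain ⟨u, rfl⟩ := exists_total_eq (f := toUnit C) φ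
    (isHomLift_toUnit (obj_fib W) (obj_fib (unitObj (F := c.pseudofunctor) R1)) φ)
  exact congrArg _ (Unique.eq_default u)

end

/-- Right adjoints of `L` and `L¹` give products in `𝒳` that are compatible with `P`. -/
noncomputable def liftedProductsOfAdjunctions
    {R : prodPseudo c.pseudofunctor ⟶ tensorPseudo c.pseudofunctor}
    {R1 : unitPseudo ⟶ pointPseudo c.pseudofunctor}
    (adj : Bicategory.Adjunction (a := tensorPseudo c.pseudofunctor)
      (b := prodPseudo c.pseudofunctor) (L c.pseudofunctor) R)
    (adj1 : Bicategory.Adjunction (a := pointPseudo c.pseudofunctor)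
      (b := unitPseudo.{v₂, u₂}) (L1 c.pseudofunctor) R1) : LiftedProducts c where
  tens {A B} X Y := tens (A := A) (B := B) R X Y
  p₁ {A B} X Y := c.total (fst A B) (counitApp₁ adj (A := A) (B := B) X Y)
  p₂ {A B} X Y := c.total (snd A B) (counitApp₂ adj (A := A) (B := B) X Y)
  p₁_over {A B} X Y := isHomLift_total (fst A B) _
  p₂_over {A B} X Y := isHomLift_total (snd A B) _
  -- The vertex `W` of an arbitrary cone is placed in the fibre over `P.obj W`.
  isLimit {A B} X Y := Limits.BinaryFan.IsLimit.mk _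
    (fun {W} φ ψ => (exists_pairing adj (A := A) (B := B) X Y (C := P.obj W)
      (W := Fiber.mk (p := P) (a := W) rfl) φ ψ).choose)
    (fun {W} φ ψ => (exists_pairing adj (A := A) (B := B) X Y (C := P.obj W)
      (W := Fiber.mk (p := P) (a := W) rfl) φ ψ).choose_spec.1)
    (fun {W} φ ψ => (exists_pairing adj (A := A) (B := B) X Y (C := P.obj W)
      (W := Fiber.mk (p := P) (a := W) rfl) φ ψ).choose_spec.2)
    (fun {W} φ ψ m h₁ h₂ => pairing_ext adj (A := A) (B := B) X Y (C := P.obj W)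
      (W := Fiber.mk (p := P) (a := W) rfl)
      (h₁.trans (exists_pairing adj (A := A) (B := B) X Y (C := P.obj W)
        (W := Fiber.mk (p := P) (a := W) rfl) φ ψ).choose_spec.1.symm)
      (h₂.trans (exists_pairing adj (A := A) (B := B) X Y (C := P.obj W)
        (W := Fiber.mk (p := P) (a := W) rfl) φ ψ).choose_spec.2.symm))
  unit := unitObj (F := c.pseudofunctor) R1
  isTerminal :=
    have (W : 𝒳) : Nonempty (Unique (W ⟶ (c.fib (𝟙_ 𝒮)).obj (unitObj (F := c.pseudofunctor) R1))) :=
      nonempty_unique_hom_unitObj adj1 (C := P.obj W) (Fiber.mk (p := P) (a := W) rfl)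
    @Limits.IsTerminal.ofUnique _ _ _ fun W => (this W).some
  cocartesian {A A' B B'} a b X Y q h₁ h₂ := by
    -- Both arrows have the projections of the product of the liftings; the right-hand one is
    -- cocartesian since the comparison is invertible.
    have h : q = c.total (a ⊗ₘ b) (comparison R a b X Y) := by
      refine pairing_ext adj (A := A') (B := B') (c.obj a X) (c.obj b Y) (C := A ⊗ B)
        (W := tens R (A := A) (B := B) X Y) (h₁.trans ?_) (h₂.trans ?_)
      · exact (total_comparison_comp₁ adj (A := A) (B := B) X Y a b).symm
      · exact (total_comparison_comp₂ adj (A := A) (B := B) X Y a b).symm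
    rw [h]
    exact cocartesian_total _ _ (isIso_comparison _ R a b X Y)

theorem exists_isCartesianMonoidalOpfibration_of_hasRightAdjoint
    (h1 : L1HasRightAdjoint c.pseudofunctor) (h : LHasRightAdjoint c.pseudofunctor) :
    ∃ _ : CartesianMonoidalCategory 𝒳, IsCartesianMonoidalOpfibration P := by
  obtain ⟨⟨h1⟩⟩ := h1
  obtain ⟨⟨h⟩⟩ := h
  exact (liftedProductsOfAdjunctions h.adj h1.adj).exists_isCartesianMonoidalOpfibration

end

end CartOpfib

theorem theorem4p8 {𝒮 : Type u₁} [Category.{v₁} 𝒮] [CartesianMonoidalCategory 𝒮]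
    {𝒳 : Type u₂} [Category.{v₂} 𝒳] (P : 𝒳 ⥤ 𝒮) (c : CartOpfib.Cleavage P) :
    List.TFAE [
      ∃ _ : CartesianMonoidalCategory 𝒳, CartOpfib.IsCartesianMonoidalOpfibration P,
      CartOpfib.L1HasRightAdjoint c.pseudofunctor ∧ CartOpfib.LHasRightAdjoint c.pseudofunctor,
      ∃ M : CartOpfib.LaxSymmetricMonoidal c.pseudofunctor,
        Nonempty (CartOpfib.TensorIsProduct c M.R) ∧ CartOpfib.UnitIsTerminal c M.R1] := by
  tfae_have 1 → 3 := fun ⟨_, H⟩ =>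
    ⟨H.laxSymmetricMonoidal c, ⟨H.tensorIsProduct⟩, H.isTerminal_unitTrans⟩
  tfae_have 1 → 2 := fun ⟨_, H⟩ =>
    ⟨H.L1HasRightAdjoint_pseudofunctor c, H.LHasRightAdjoint_pseudofunctor c⟩
  tfae_have 2 → 1 := fun ⟨h1, h⟩ =>
    CartOpfib.exists_isCartesianMonoidalOpfibration_of_hasRightAdjoint h1 h
  tfae_have 3 → 1 := fun ⟨M, ⟨hR⟩, hR1⟩ =>
    (hR.liftedProducts hR1).exists_isCartesianMonoidalOpfibration
  tfae_finish
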